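/- Notation. $\|\cdot\|$ is the spectral norm and $\kappa(A)=\sigma_{\max}(A)/\sigma_{\min}(A)$ for a matrix $A$ with linearly independent columns. Let $0<\varepsilon_h\le\varepsilon_\ell<1$ be the unit roundoffs of a high and a low precision, in the standard model of floating-point arithmetic (every elementary operation or conversion with exact value $x$ returns $x(1+\delta)$ with $|\delta|\le\varepsilon$; sums may be evaluated in any order). Let $m,p,s\ge1$ and let $\boldsymbol{\mathcal X}=[X_1,\dots,X_p]\in\mathbb R^{m\times ps}$, with blocks $X_k\in\mathbb R^{m\times s}$, have linearly independent columns. Write $\boldsymbol{\mathcal X}_k=[X_1,\dots,X_k]$, and for a $ps\times ps$ block matrix $\mathcal R=(R_{ij})$ write $\mathcal R_k$ for its leading $ks\times ks$ submatrix and $\mathcal R_{1:k-1,k}$ for its $k$-th block column above the diagonal block. "$O(\varepsilon)$" means $c(m,ps)\,\varepsilon$ with a polynomial $c$ in the dimensions; the polynomials in the conclusions depend only on the one in the assumption on $\mathrm{IO}$. Algorithm (two-precision BCGS-PIP with intraorthogonalization routine $\mathrm{IO}$). Compute $[\bar Q_1,\bar R_{11}]=\mathrm{IO}(X_1)$. For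 $k=2,\dots,p$ compute $\bar{\mathcal R}_{1:k-1,k}=\bar{\boldsymbol{\mathcal Q}}_{k-1}^TX_k$ in low precision; $\bar P_k=X_k^TX_k$, then $\bar H_k=\bar P_k-\bar{\mathcal R}_{1:k-1,k}^T\bar{\mathcal R}_{1:k-1,k}$, then the upper triangular Cholesky factor $\bar R_{kk}$ of $\bar H_k$, all in high precision; $\bar V_k=X_k-\bar{\boldsymbol{\mathcal Q}}_{k-1}\bar{\mathcal R}_{1:k-1,k}$ in low precision; $\bar Q_k=\bar V_k\bar R_{kk}^{-1}$ by substitution in high precision, using the high-precision $\bar R_{kk}$; finally round $\bar Q_k$ and $\bar R_{kk}$ to low precision. Let $\bar{\boldsymbol{\mathcal Q}},\bar{\mathcal R}$ be the output of a completed run (all Cholesky pivots positive), where $\bar{\mathcal R}$ is block upper triangular and $\bar R_{kk}$, $\bar Q_k$ below denote the final, rounded blocks. Error constants. Nonnegative numbers $\xi_1,\rho_1,\delta_{Q^TX},\delta_{X^TX},\delta_{R^TR},\delta_{\mathrm{chol}},\delta_{QR},\delta_Q$ are called valid for the run if $\|\bar R_{11}^T\bar R_{11}-X_1^TX_1\|\le\xi_1\|X_1\|^2$,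 $\|\bar Q_1\bar R_{11}-X_1\|\le\rho_1(\|X_1\|+\|\bar Q_1\|\|\bar R_{11}\|)$, and for all $2\le k\le p$: $\|\bar{\mathcal R}_{1:k-1,k}-\bar{\boldsymbol{\mathcal Q}}_{k-1}^TX_k\|\le\delta_{Q^TX}\|X_k\|$, $\|\bar P_k-X_k^TX_k\|\le\delta_{X^TX}\|X_k\|^2$, $\|\bar H_k-(\bar P_k-\bar{\mathcal R}_{1:k-1,k}^T\bar{\mathcal R}_{1:k-1,k})\|\le\delta_{R^TR}\|X_k\|^2$, $\|\bar R_{kk}^T\bar R_{kk}-\bar H_k\|\le\delta_{\mathrm{chol}}\|X_k\|^2$, $\|\bar V_k-(X_k-\bar{\boldsymbol{\mathcal Q}}_{k-1}\bar{\mathcal R}_{1:k-1,k})\|\le\delta_{QR}\|X_k\|$, $\|\bar Q_k\bar R_{kk}-\bar V_k\|\le\delta_Q\|\bar Q_k\|\|\bar R_{kk}\|$. For such constants put, for $2\le k\le p$, $$\rho_k=6\rho_{k-1}+\delta_{QR}+\delta_Q,\qquad \xi_k=\xi_{k-1}+12\rho_{k-1}+2\sqrt2\,\delta_{Q^TX}+\delta_{X^TX}+\delta_{\mathrm{chol}}+\delta_{R^TR},$$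 and $\rho_{\max}=\max_{1\le k\le p-1}\rho_k$, $\xi_{\max}=\max_{1\le k\le p-1}\xi_k$ (both $0$ if $p=1$). Theorem. Assume that for all $X\in\mathbb R^{m\times s}$ with linearly independent columns and $\kappa(X)\le\kappa(\boldsymbol{\mathcal X})$, $[\bar Q,\bar R]=\mathrm{IO}(X)$ satisfies $\|\bar R^T\bar R-X^TX\|\le O(\varepsilon_\ell)\|X\|^2$ and $\|\bar Q\bar R-X\|\le O(\varepsilon_\ell)\|X\|$. (a) If, for some valid error constants, $$(\rho_{\max}+\rho_p)\,\kappa^2(\boldsymbol{\mathcal X})\le\tfrac14\quad\text{and}\quad(\xi_{\max}+\xi_p)\,\kappa^2(\boldsymbol{\mathcal X})\le\tfrac12,$$ then for all $k\in\{1,\dots,p\}$ $$\|\bar{\mathcal R}_k^T\bar{\mathcal R}_k-\boldsymbol{\mathcal X}_k^T\boldsymbol{\mathcal X}_k\|\le O(\varepsilon_\ell)\|\boldsymbol{\mathcal X}_k\|^2,\quad \|\bar{\boldsymbol{\mathcal Q}}_k\bar{\mathcal R}_k-\boldsymbol{\mathcal X}_k\|\le O(\varepsilon_\ell)\|\boldsymbol{\mathcal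 X}_k\|,\quad \|I-\bar{\boldsymbol{\mathcal Q}}_k^T\bar{\boldsymbol{\mathcal Q}}_k\|\le O(\varepsilon_\ell)\,\kappa^2(\boldsymbol{\mathcal X}_k).$$ (b) There is a polynomial $c$ such that the constants $\xi_1=\rho_1=\delta_{Q^TX}=\delta_{\mathrm{chol}}=\delta_{QR}=\delta_Q=c(m,ps)\,\varepsilon_\ell$ and $\delta_{X^TX}=\delta_{R^TR}=c(m,ps)\,\varepsilon_h$ are valid whenever the $\rho_k,\xi_k$ formed from them satisfy the two inequalities in (a). -/

import Mathlib

open scoped Matrix Matrix.Norms.L2Operator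

noncomputable section

namespace BlockGS

/-! Throughout, `‖A‖` is the induced matrix 2-norm. -/

/-- The 2-norm condition number of a matrix with linearly independent columns: the ratio of its
largest to its smallest singular value. -/
def condNum {m n : Type*} [Fintype m] [Fintype n] [DecidableEq n] (A : Matrix m n ℝ) : ℝ :=
  (Matrix.toEuclideanLin A).singularValues 0 /
    (Matrix.toEuclideanLin A).singularValues (Fintype.card n - 1)

/-! ### Blocks

An `m × ps` matrix has its columns indexed by `Fin p × Fin s`: block number, column in the block. -/

/-- The `k`-th block vector of `X`, with `k` counted from `0`. -/
def blk {m p s : ℕ} (X : Matrix (Fin m) (Fin p × Fin s) ℝ) (k : Fin p) :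
    Matrix (Fin m) (Fin s) ℝ :=
  X.submatrix id (fun j => (k, j))

/-- The inclusion of the first `k` blocks of indices. -/
def inclBlk {p k : ℕ} (s : ℕ) (hk : k ≤ p) : Fin k × Fin s → Fin p × Fin s :=
  fun x => (Fin.castLE hk x.1, x.2)

/-- The concatenation of the first `k` block vectors of `X`. -/
def lead {m p s k : ℕ} (X : Matrix (Fin m) (Fin p × Fin s) ℝ) (hk : k ≤ p) :
    Matrix (Fin m) (Fin k × Fin s) ℝ :=
  X.submatrix id (inclBlk s hk)

/-- The leading `ks × ks` submatrix of a `ps × ps` matrix. -/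
def leadSq {p s k : ℕ} (R : Matrix (Fin p × Fin s) (Fin p × Fin s) ℝ) (hk : k ≤ p) :
    Matrix (Fin k × Fin s) (Fin k × Fin s) ℝ :=
  R.submatrix (inclBlk s hk) (inclBlk s hk)

/-- The part of block column `k` (counted from `0`) of `R` strictly above the diagonal block. -/
def above {p s : ℕ} (R : Matrix (Fin p × Fin s) (Fin p × Fin s) ℝ) (k : Fin p) :
    Matrix (Fin (k : ℕ) × Fin s) (Fin s) ℝ :=
  R.submatrix (inclBlk s k.isLt.le) (fun j => (k, j))

/-- The diagonal block number `k` (counted from `0`) of `R`. -/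
def diagBlk {p s : ℕ} (R : Matrix (Fin p × Fin s) (Fin p × Fin s) ℝ) (k : Fin p) :
    Matrix (Fin s) (Fin s) ℝ :=
  R.submatrix (fun j => (k, j)) (fun j => (k, j))

/-! ### The standard model of floating-point arithmetic

The result `y` of an elementary operation (or of a conversion) with exact value `x`, carried out
with unit roundoff `u`, satisfies `y = x (1 + δ)` with `|δ| ≤ u`. -/

/-- `y` is an admissible rounding of `x` with unit roundoff `u`. -/
def Rounds (u x y : ℝ) : Prop :=
  ∃ δ : ℝ, |δ| ≤ u ∧ y = x * (1 + δ)

/-- `FlSum u S c`: `c` is a possible result of adding up the elements of the nonempty multiset `S`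
with unit roundoff `u`, in an arbitrary order of evaluation (each addition being rounded). -/
inductive FlSum (u : ℝ) : Multiset ℝ → ℝ → Prop
  | single (x : ℝ) : FlSum u {x} x
  | add {S T : Multiset ℝ} {a b c : ℝ} :
      FlSum u S a → FlSum u T b → Rounds u (a + b) c → FlSum u (S + T) c

/-- `C` is a possible computed value of the matrix product `A * B`. -/
def FlMul {l n r : Type*} [Fintype n] (u : ℝ) (A : Matrix l n ℝ) (B : Matrix n r ℝ)
    (C : Matrix l r ℝ) : Prop :=
  ∀ i j, ∃ z : n → ℝ, (∀ t, Rounds u (A i t * B t j) (z t)) ∧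
    FlSum u (Finset.univ.val.map z) (C i j)

/-- `C` is a possible computed value of the difference `A - B`. -/
def FlSub {l r : Type*} (u : ℝ) (A B C : Matrix l r ℝ) : Prop :=
  ∀ i j, Rounds u (A i j - B i j) (C i j)

/-- `C` is a possible result of converting `A` to a format with unit roundoff `u`. -/
def FlCast {l r : Type*} (u : ℝ) (A C : Matrix l r ℝ) : Prop :=
  ∀ i j, Rounds u (A i j) (C i j)

/-- `d` is a possible computed value of `a - ∑ l < i, f l * g l`, in any order of evaluation. -/
def FlSubDot {s : ℕ} (u a : ℝ) (i : Fin s) (f g : Fin s → ℝ) (d : ℝ) : Prop :=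
  ∃ z : Fin s → ℝ, (∀ l, l < i → Rounds u (f l * g l) (z l)) ∧
    FlSum u (a ::ₘ (Finset.univ.filter (fun l => l < i)).val.map (fun l => -z l)) d

/-- `R` is a possible upper triangular factor computed by the Cholesky algorithm applied to `A`
(of which only the upper triangle is read), run to completion, that is, with positive pivots. -/
def FlChol {s : ℕ} (u : ℝ) (A R : Matrix (Fin s) (Fin s) ℝ) : Prop :=
  (∀ i j, j < i → R i j = 0) ∧
  (∀ i, ∃ d, FlSubDot u (A i i) i (fun l => R l i) (fun l => R l i) d ∧ 0 < d ∧
    Rounds u (Real.sqrt d) (R i i)) ∧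
  (∀ i j, i < j → ∃ t, FlSubDot u (A i j) i (fun l => R l i) (fun l => R l j) t ∧
    Rounds u (t / R i i) (R i j))

/-- `Y` is a possible computed value of `V * R⁻¹` for an upper triangular `R`, where each row of
`Y * R = V` is solved by substitution. -/
def FlTriSolve {m s : ℕ} (u : ℝ) (V : Matrix (Fin m) (Fin s) ℝ) (R : Matrix (Fin s) (Fin s) ℝ)
    (Y : Matrix (Fin m) (Fin s) ℝ) : Prop :=
  ∀ i j, ∃ t, FlSubDot u (V i j) j (fun l => Y i l) (fun l => R l j) t ∧
    Rounds u (t / R j j) (Y i j)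

/-! ### Two-precision BCGS-PIP -/

/-- The quantities computed in the course of one execution of two-precision BCGS-PIP. For the first
block only `Q` and `R` are meaningful. -/
structure Trace (m p s : ℕ) where
  /-- the returned basis -/
  Q : Matrix (Fin m) (Fin p × Fin s) ℝ
  /-- the returned triangular factor -/
  R : Matrix (Fin p × Fin s) (Fin p × Fin s) ℝ
  /-- the Gram matrices `P_k` of the block vectors -/
  P : Fin p → Matrix (Fin s) (Fin s) ℝ
  /-- the products of `R_{1:k-1,k}` transposed with `R_{1:k-1,k}` -/
  G : Fin p → Matrix (Fin s) (Fin s) ℝ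
  /-- the arguments of the Cholesky factorization -/
  H : Fin p → Matrix (Fin s) (Fin s) ℝ
  /-- the Cholesky factors in high precision -/
  Rhi : Fin p → Matrix (Fin s) (Fin s) ℝ
  /-- the products of `Q_{1:k-1}` with `R_{1:k-1,k}` -/
  W : Fin p → Matrix (Fin m) (Fin s) ℝ
  /-- the projected block vectors `V_k` -/
  V : Fin p → Matrix (Fin m) (Fin s) ℝ
  /-- the normalized block vectors in high precision -/
  Qhi : Fin p → Matrix (Fin m) (Fin s) ℝ

/-- `t` is a (completed) execution of two-precision BCGS-PIP on `X`, with the intraorthogonalization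
routine `intra`, in the standard model with high-precision unit roundoff `εh` and low-precision unit
roundoff `εl`. -/
structure IsPIPMP {m p s : ℕ} (εh εl : ℝ) (X : Matrix (Fin m) (Fin p × Fin s) ℝ)
    (intra : Matrix (Fin m) (Fin s) ℝ → Matrix (Fin m) (Fin s) ℝ × Matrix (Fin s) (Fin s) ℝ)
    (t : Trace m p s) : Prop where
  lower : ∀ (i j : Fin p) (a b : Fin s), j < i → t.R (i, a) (j, b) = 0
  first : ∀ k : Fin p, (k : ℕ) = 0 → (blk t.Q k, diagBlk t.R k) = intra (blk X k)
  inner : ∀ k : Fin p, 0 < (k : ℕ) →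
    FlMul εl (lead t.Q k.isLt.le)ᵀ (blk X k) (above t.R k)
  gram : ∀ k : Fin p, 0 < (k : ℕ) → FlMul εh (blk X k)ᵀ (blk X k) (t.P k)
  pyth : ∀ k : Fin p, 0 < (k : ℕ) → FlMul εh (above t.R k)ᵀ (above t.R k) (t.G k)
  sub : ∀ k : Fin p, 0 < (k : ℕ) → FlSub εh (t.P k) (t.G k) (t.H k)
  chol : ∀ k : Fin p, 0 < (k : ℕ) → FlChol εh (t.H k) (t.Rhi k)
  prod : ∀ k : Fin p, 0 < (k : ℕ) → FlMul εl (lead t.Q k.isLt.le) (above t.R k) (t.W k)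
  proj : ∀ k : Fin p, 0 < (k : ℕ) → FlSub εl (blk X k) (t.W k) (t.V k)
  solve : ∀ k : Fin p, 0 < (k : ℕ) → FlTriSolve εh (t.V k) (t.Rhi k) (t.Qhi k)
  castQ : ∀ k : Fin p, 0 < (k : ℕ) → FlCast εl (t.Qhi k) (blk t.Q k)
  castR : ∀ k : Fin p, 0 < (k : ℕ) → FlCast εl (t.Rhi k) (diagBlk t.R k)

/-! ### The error constants and the quantities `ρ_k`, `ξ_k` -/

/-- Constants for the errors in the individual steps of BCGS-PIP: `ξ₁`, `ρ₁` for the first block,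
and one for each of `Q_{1:k-1}ᵀ X_k`, `X_kᵀ X_k`, the subtraction of `R_{1:k-1,k}ᵀ R_{1:k-1,k}`, the
Cholesky factorization, `X_k - Q_{1:k-1} R_{1:k-1,k}`, and `V_k R_kk⁻¹`. -/
structure ErrConsts where
  ξ₁ : ℝ
  ρ₁ : ℝ
  δQX : ℝ
  δXX : ℝ
  δRR : ℝ
  δchol : ℝ
  δQR : ℝ
  δQ : ℝ

namespace ErrConsts

/-- `ρ_k`, for `k ≥ 1`. -/
def rho (e : ErrConsts) : ℕ → ℝ
  | 0 => 0
  | 1 => e.ρ₁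
  | k + 2 => 6 * rho e (k + 1) + e.δQR + e.δQ

/-- `ξ_k`, for `k ≥ 1`. -/
def xi (e : ErrConsts) : ℕ → ℝ
  | 0 => 0
  | 1 => e.ξ₁
  | k + 2 => xi e (k + 1) + 12 * e.rho (k + 1) + 2 * Real.sqrt 2 * e.δQX + e.δXX + e.δchol + e.δRR

/-- The maximum of `ρ_1, …, ρ_{p-1}` (zero if `p = 1`). -/
def rhoMax (e : ErrConsts) (p : ℕ) : ℝ := ⨆ k : Fin (p - 1), e.rho (k + 1)

/-- The maximum of `ξ_1, …, ξ_{p-1}` (zero if `p = 1`). -/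
def xiMax (e : ErrConsts) (p : ℕ) : ℝ := ⨆ k : Fin (p - 1), e.xi (k + 1)

/-- The restriction on the condition number of `X`. -/
def Small {m p s : ℕ} (e : ErrConsts) (X : Matrix (Fin m) (Fin p × Fin s) ℝ) : Prop :=
  (e.rhoMax p + e.rho p) * condNum X ^ 2 ≤ 1 / 4 ∧
  (e.xiMax p + e.xi p) * condNum X ^ 2 ≤ 1 / 2

/-- `e` consists of nonnegative constants that bound the errors in the individual steps of the
execution `t`. -/
structure Bounds {m p s : ℕ} (e : ErrConsts) (X : Matrix (Fin m) (Fin p × Fin s) ℝ)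
    (t : Trace m p s) : Prop where
  nonneg : 0 ≤ e.ξ₁ ∧ 0 ≤ e.ρ₁ ∧ 0 ≤ e.δQX ∧ 0 ≤ e.δXX ∧ 0 ≤ e.δRR ∧ 0 ≤ e.δchol ∧
    0 ≤ e.δQR ∧ 0 ≤ e.δQ
  firstChol : ∀ k : Fin p, (k : ℕ) = 0 →
    ‖(diagBlk t.R k)ᵀ * diagBlk t.R k - (blk X k)ᵀ * blk X k‖ ≤ e.ξ₁ * ‖blk X k‖ ^ 2
  firstRes : ∀ k : Fin p, (k : ℕ) = 0 →
    ‖blk t.Q k * diagBlk t.R k - blk X k‖ ≤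
      e.ρ₁ * (‖blk X k‖ + ‖blk t.Q k‖ * ‖diagBlk t.R k‖)
  inner : ∀ k : Fin p, 0 < (k : ℕ) →
    ‖above t.R k - (lead t.Q k.isLt.le)ᵀ * blk X k‖ ≤ e.δQX * ‖blk X k‖
  gram : ∀ k : Fin p, 0 < (k : ℕ) →
    ‖t.P k - (blk X k)ᵀ * blk X k‖ ≤ e.δXX * ‖blk X k‖ ^ 2
  pyth : ∀ k : Fin p, 0 < (k : ℕ) →
    ‖t.H k - (t.P k - (above t.R k)ᵀ * above t.R k)‖ ≤ e.δRR * ‖blk X k‖ ^ 2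
  chol : ∀ k : Fin p, 0 < (k : ℕ) →
    ‖(diagBlk t.R k)ᵀ * diagBlk t.R k - t.H k‖ ≤ e.δchol * ‖blk X k‖ ^ 2
  proj : ∀ k : Fin p, 0 < (k : ℕ) →
    ‖t.V k - (blk X k - lead t.Q k.isLt.le * above t.R k)‖ ≤ e.δQR * ‖blk X k‖
  solve : ∀ k : Fin p, 0 < (k : ℕ) →
    ‖blk t.Q k * diagBlk t.R k - t.V k‖ ≤ e.δQ * (‖blk t.Q k‖ * ‖diagBlk t.R k‖)

end ErrConsts

/-- The value of a polynomial in two variables at the dimensions `(m, p * s)`. -/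
def dimConst (c : MvPolynomial (Fin 2) ℝ) (m p s : ℕ) : ℝ :=
  MvPolynomial.eval ![(m : ℝ), ((p * s : ℕ) : ℝ)] c

end BlockGS

end

set_option linter.unusedSectionVars false

noncomputable section

namespace BlockGS

/-! ### Spectral norm: entries, submatrices and block partitions. -/

section Norms

variable {l m n r α β : Type*} [Fintype l] [Fintype m] [Fintype n] [Fintype r] [Fintype α]
  [Fintype β] [DecidableEq l] [DecidableEq m] [DecidableEq n] [DecidableEq r] [DecidableEq α]
  [DecidableEq β]

/-! Accuracy forces conditioning. Suppose `RᵀR` is close to `XᵀX` and `QR` to `X`, with errors small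
against `sigmaMin X ^ 2`. Then `R` is invertible, its inverse `Y` has norm of order `1 / sigmaMin
X`, and `Q = XY + (QR - X)Y` is bounded by an absolute constant (`norm_basis_mul_le`). The same
inverse turns the Gram error and the residual into the loss of orthogonality, at the price of the
squared condition number (`norm_one_sub_gram_le`).

Appending a block gives recursions for the Gram error and the residual (`gramErr_succ_le`,
`resErr_succ_le`). They rest on exact identities that never use orthogonality of `Q`, only bounds
for the factors of the earlier blocks. The smallness assumption supplies those bounds, and the
induction closes with `ξ_k` and `ρ_k` (`gramErr_resErr_le`). The residual is measured against `‖X‖ +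
‖Q‖ * ‖R‖` because the newest `Q` is not yet bounded when its residual is estimated.

For the explicit constants, a rounding error analysis shows that processing one block satisfies
bounds of the order of the roundoffs once the preceding basis has norm at most 2
(`IsPIPMP.stepBounds`). That norm bound comes from the accuracy of the preceding blocks, so validity
follows by strong induction on the block number (`IsPIPMP.bounds_unitConsts`).

The accuracy claim needs one more idea: arbitrary valid constants need not be of order `εl`, and
`ρ_k` can grow like `6 ^ k`. They therefore serve only to bound `Q` and `R`. With these bounds the
rounding analysis is run again with its own constants, and errors now accumulate polynomially
(`resErr_gramErr_le_of_bounded`). If the roundoff is too large for that analysis, the claimed bounds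
exceed trivial ones. -/

theorem norm_toEuclideanLin_le (A : Matrix m n ℝ) (v : EuclideanSpace ℝ n) :
    ‖Matrix.toEuclideanLin A v‖ ≤ ‖A‖ * ‖v‖ := Matrix.l2_opNorm_mulVec A v

theorem norm_le_of_forall_toEuclideanLin {A : Matrix m n ℝ} {c : ℝ} (hc : 0 ≤ c)
    (h : ∀ v, ‖Matrix.toEuclideanLin A v‖ ≤ c * ‖v‖) : ‖A‖ ≤ c := by
  rw [Matrix.l2_opNorm_def]
  exact ContinuousLinearMap.opNorm_le_bound _ hc h

theorem norm_transpose (A : Matrix m n ℝ) : ‖Aᵀ‖ = ‖A‖ := by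
  simpa [Matrix.conjTranspose_eq_transpose_of_trivial] using Matrix.l2_opNorm_conjTranspose A

theorem norm_transpose_mul_self (A : Matrix m n ℝ) : ‖Aᵀ * A‖ = ‖A‖ ^ 2 := by
  simpa [Matrix.conjTranspose_eq_transpose_of_trivial, sq] using
    Matrix.l2_opNorm_conjTranspose_mul_self A

theorem norm_mul_le' (A : Matrix l m ℝ) (B : Matrix m n ℝ) : ‖A * B‖ ≤ ‖A‖ * ‖B‖ :=
  Matrix.l2_opNorm_mul A B

theorem norm_one_le : ‖(1 : Matrix n n ℝ)‖ ≤ 1 := by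
  refine norm_le_of_forall_toEuclideanLin zero_le_one fun v => ?_
  simp [Matrix.toEuclideanLin, Matrix.toLpLin]

theorem norm_eq_zero_of_isEmpty_right [IsEmpty n] (A : Matrix m n ℝ) : ‖A‖ = 0 := by
  rw [Subsingleton.elim A 0, norm_zero]

theorem norm_eq_zero_of_isEmpty_left [IsEmpty m] (A : Matrix m n ℝ) : ‖A‖ = 0 := by
  rw [Subsingleton.elim A 0, norm_zero]

theorem abs_apply_le_norm (A : Matrix m n ℝ) (i : m) (j : n) : |A i j| ≤ ‖A‖ := by
  have h := norm_toEuclideanLin_le A (EuclideanSpace.single j 1)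
  rw [PiLp.norm_single, norm_one, mul_one] at h
  refine le_trans ?_ h
  have := PiLp.norm_apply_le (Matrix.toEuclideanLin A (EuclideanSpace.single j 1)) i
  simpa [Matrix.toEuclideanLin, Matrix.toLpLin] using this

/-- A crude passage from entrywise to spectral bounds. The loss is polynomial in the dimensions,
which is all that the final constants have to respect. -/
theorem norm_le_of_forall_abs_le {A : Matrix m n ℝ} {c : ℝ} (hc : 0 ≤ c)
    (h : ∀ i j, |A i j| ≤ c) : ‖A‖ ≤ Fintype.card m * Fintype.card n * c := by
  refine norm_le_of_forall_toEuclideanLin (by positivity) fun v => ?_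
  set w := Matrix.toEuclideanLin A v with hw
  have h1 : ‖w‖ ≤ ∑ i, |w i| := by
    conv_lhs => rw [← (EuclideanSpace.basisFun m ℝ).sum_repr w]
    refine (norm_sum_le _ _).trans (le_of_eq ?_)
    refine Finset.sum_congr rfl fun i _ => ?_
    simp [norm_smul]
  refine h1.trans ?_
  have h2 : ∀ i, |w i| ≤ Fintype.card n * c * ‖v‖ := fun i => by
    have : w i = ∑ j, A i j * v j := by
      simp [hw, Matrix.toEuclideanLin, Matrix.toLpLin, Matrix.mulVec, dotProduct]
    rw [this]
    refine (Finset.abs_sum_le_sum_abs _ _).trans ?_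
    calc ∑ j, |A i j * v j| ≤ ∑ _j : n, c * ‖v‖ := by
          refine Finset.sum_le_sum fun j _ => ?_
          rw [abs_mul]
          exact mul_le_mul (h i j) (PiLp.norm_apply_le v j) (abs_nonneg _) hc
      _ = _ := by simp [mul_assoc]
  calc ∑ i, |w i| ≤ ∑ _i : m, Fintype.card n * c * ‖v‖ := Finset.sum_le_sum fun i _ => h2 i
    _ = _ := by simp [mul_assoc]

theorem submatrix_id_eq_mul (A : Matrix m n ℝ) (f : α → n) :
    A.submatrix id f = A * (1 : Matrix n n ℝ).submatrix id f := by
  ext i j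
  simp [Matrix.mul_apply, Matrix.one_apply]

/-- The selection matrix `J` satisfies `JᵀJ = 1`, so it is an isometry; selecting columns is
multiplication by it. -/
theorem norm_one_submatrix_le {f : α → n} (hf : Function.Injective f) :
    ‖(1 : Matrix n n ℝ).submatrix id f‖ ≤ 1 := by
  have h : ((1 : Matrix n n ℝ).submatrix id f)ᵀ * (1 : Matrix n n ℝ).submatrix id f = 1 := by
    ext i j
    simp [Matrix.mul_apply, Matrix.one_apply, hf.eq_iff]
  have h2 := norm_transpose_mul_self ((1 : Matrix n n ℝ).submatrix id f)
  rw [h] at h2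
  exact (sq_le_one_iff₀ (norm_nonneg _)).1 (h2 ▸ norm_one_le)

theorem norm_submatrix_cols_le (A : Matrix m n ℝ) {f : α → n} (hf : Function.Injective f) :
    ‖A.submatrix id f‖ ≤ ‖A‖ := by
  rw [submatrix_id_eq_mul]
  refine (norm_mul_le' _ _).trans ?_
  exact mul_le_of_le_one_right (norm_nonneg _) (norm_one_submatrix_le hf)

theorem norm_submatrix_le (A : Matrix m n ℝ) {g : β → m} {f : α → n}
    (hg : Function.Injective g) (hf : Function.Injective f) : ‖A.submatrix g f‖ ≤ ‖A‖ := by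
  have h : A.submatrix g f = ((A.submatrix id f)ᵀ.submatrix id g)ᵀ := rfl
  rw [h, norm_transpose]
  refine (norm_submatrix_cols_le _ hg).trans ?_
  rw [norm_transpose]
  exact norm_submatrix_cols_le _ hf

/-- The matrix product splits along a partition of the inner index set. -/
theorem mul_eq_add_of_bijective {l r : Type*} (A : Matrix l n ℝ) (B : Matrix n r ℝ)
    {f : α → n} {g : β → n} (h : Function.Bijective (Sum.elim f g)) :
    A * B = A.submatrix id f * B.submatrix f id + A.submatrix id g * B.submatrix g id := by
  ext i j
  simp only [Matrix.mul_apply, Matrix.add_apply, Matrix.submatrix_apply, id]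
  rw [← h.sum_comp]
  simp

theorem norm_le_add_of_bijective_cols (A : Matrix m n ℝ) {f : α → n} {g : β → n}
    (h : Function.Bijective (Sum.elim f g)) :
    ‖A‖ ≤ ‖A.submatrix id f‖ + ‖A.submatrix id g‖ := by
  have hf : Function.Injective f := fun a b hab => Sum.inl_injective (h.1 (by simpa using hab))
  have hg : Function.Injective g := fun a b hab => Sum.inr_injective (h.1 (by simpa using hab))
  conv_lhs => rw [← Matrix.mul_one A, mul_eq_add_of_bijective A 1 h]
  refine (norm_add_le _ _).trans (add_le_add ?_ ?_)
  · refine (norm_mul_le' _ _).trans (mul_le_of_le_one_right (norm_nonneg _) ?_)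
    exact (norm_submatrix_le _ hf Function.injective_id).trans norm_one_le
  · refine (norm_mul_le' _ _).trans (mul_le_of_le_one_right (norm_nonneg _) ?_)
    exact (norm_submatrix_le _ hg Function.injective_id).trans norm_one_le

theorem norm_le_add_of_bijective (A : Matrix n n ℝ) {f : α → n} {g : β → n}
    (h : Function.Bijective (Sum.elim f g)) :
    ‖A‖ ≤ ‖A.submatrix f f‖ + ‖A.submatrix g f‖ + (‖A.submatrix f g‖ + ‖A.submatrix g g‖) := by
  refine (norm_le_add_of_bijective_cols A h).trans (add_le_add ?_ ?_)
  · rw [← norm_transpose]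
    refine (norm_le_add_of_bijective_cols _ h).trans (le_of_eq ?_)
    rw [← norm_transpose (A.submatrix f f), ← norm_transpose (A.submatrix g f)]
    rfl
  · rw [← norm_transpose]
    refine (norm_le_add_of_bijective_cols _ h).trans (le_of_eq ?_)
    rw [← norm_transpose (A.submatrix f g), ← norm_transpose (A.submatrix g g)]
    rfl

end Norms

/-! ### Extreme singular values as the extreme stretching factors. -/

section Singular

open LinearMap

variable {E F : Type*} [NormedAddCommGroup E] [InnerProductSpace ℝ E] [FiniteDimensional ℝ E]
  [NormedAddCommGroup F] [InnerProductSpace ℝ F] [FiniteDimensional ℝ F]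

/-- An orthonormal eigenbasis of `T* T` diagonalizes the quadratic form `‖T v‖ ^ 2`. Both extremal
estimates below then compare this sum with `norm_sq_eq_sum_repr` term by term. -/
theorem norm_sq_eq_sum_singularValues {d : ℕ} (T : E →ₗ[ℝ] F) (hd : Module.finrank ℝ E = d)
    (v : E) : ‖T v‖ ^ 2 = ∑ i : Fin d, T.singularValues i ^ 2 *
      (T.isSymmetric_adjoint_comp_self.eigenvectorBasis hd).repr v i ^ 2 := by
  set b := T.isSymmetric_adjoint_comp_self.eigenvectorBasis hd
  have h1 : ‖T v‖ ^ 2 = inner ℝ ((adjoint T ∘ₗ T) v) v := by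
    rw [LinearMap.comp_apply, LinearMap.adjoint_inner_left, real_inner_self_eq_norm_sq]
  rw [h1, ← b.repr.inner_map_map, PiLp.inner_apply]
  refine Finset.sum_congr rfl fun i _ => ?_
  rw [T.isSymmetric_adjoint_comp_self.eigenvectorBasis_apply_self_apply hd v i,
    T.sq_singularValues_fin hd i]
  simp [b]
  ring

theorem norm_sq_eq_sum_repr {d : ℕ} (T : E →ₗ[ℝ] F) (hd : Module.finrank ℝ E = d)
    (v : E) : ‖v‖ ^ 2 = ∑ i : Fin d,
      (T.isSymmetric_adjoint_comp_self.eigenvectorBasis hd).repr v i ^ 2 := by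
  set b := T.isSymmetric_adjoint_comp_self.eigenvectorBasis hd
  rw [← b.repr.norm_map, EuclideanSpace.norm_sq_eq]
  simp

theorem norm_apply_le_singularValues_zero (T : E →ₗ[ℝ] F) (v : E) :
    ‖T v‖ ≤ T.singularValues 0 * ‖v‖ := by
  refine le_of_sq_le_sq ?_ (mul_nonneg (T.singularValues_nonneg 0) (norm_nonneg v))
  rw [mul_pow, norm_sq_eq_sum_singularValues T rfl, norm_sq_eq_sum_repr T rfl v, Finset.mul_sum]
  gcongr with i
  · exact T.singularValues_nonneg _
  · exact T.singularValues_antitone (Nat.zero_le _)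

theorem singularValues_last_mul_le (T : E →ₗ[ℝ] F) (v : E) :
    T.singularValues (Module.finrank ℝ E - 1) * ‖v‖ ≤ ‖T v‖ := by
  refine le_of_sq_le_sq ?_ (norm_nonneg _)
  rw [mul_pow, norm_sq_eq_sum_singularValues T rfl, norm_sq_eq_sum_repr T rfl v, Finset.mul_sum]
  gcongr with i
  · exact T.singularValues_nonneg _
  · exact T.singularValues_antitone (by omega)

theorem exists_norm_eq_singularValues (T : E →ₗ[ℝ] F) {i : ℕ} (hi : i < Module.finrank ℝ E) :
    ∃ v, ‖v‖ = 1 ∧ ‖T v‖ = T.singularValues i := by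
  refine ⟨T.isSymmetric_adjoint_comp_self.eigenvectorBasis rfl ⟨i, hi⟩,
    OrthonormalBasis.norm_eq_one _ _, ?_⟩
  refine (sq_eq_sq₀ (norm_nonneg _) (T.singularValues_nonneg _)).1 ?_
  rw [norm_sq_eq_sum_singularValues T rfl, Finset.sum_eq_single ⟨i, hi⟩]
  · simp
  · intro j _ hj
    simp [hj]
  · simp

end Singular

/-! ### Condition number, and its monotonicity under selecting columns. -/

section CondNum

variable {m n α : Type*} [Fintype m] [Fintype n] [Fintype α] [DecidableEq m] [DecidableEq n]
  [DecidableEq α]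

/-- The smallest singular value of a matrix with linearly independent columns. -/
def sigmaMin (A : Matrix m n ℝ) : ℝ :=
  (Matrix.toEuclideanLin A).singularValues (Fintype.card n - 1)

theorem sigmaMin_mul_le (A : Matrix m n ℝ) (v : EuclideanSpace ℝ n) :
    sigmaMin A * ‖v‖ ≤ ‖Matrix.toEuclideanLin A v‖ := by
  have := singularValues_last_mul_le (Matrix.toEuclideanLin A) v
  rwa [finrank_euclideanSpace] at this

theorem sigmaMin_nonneg (A : Matrix m n ℝ) : 0 ≤ sigmaMin A :=
  LinearMap.singularValues_nonneg _ _

theorem exists_norm_eq_sigmaMin [Nonempty n] (A : Matrix m n ℝ) :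
    ∃ v, ‖v‖ = 1 ∧ ‖Matrix.toEuclideanLin A v‖ = sigmaMin A :=
  exists_norm_eq_singularValues _ (by
    rw [finrank_euclideanSpace]; exact Nat.sub_lt Fintype.card_pos one_pos)

theorem condNum_eq [Nonempty n] (A : Matrix m n ℝ) : condNum A = ‖A‖ / sigmaMin A := by
  unfold condNum sigmaMin
  congr 1
  refine le_antisymm ?_ ?_
  · obtain ⟨v, hv, h⟩ := exists_norm_eq_singularValues (Matrix.toEuclideanLin A) (i := 0) (by
      rw [finrank_euclideanSpace]; exact Fintype.card_pos)
    rw [← h]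
    simpa [hv] using norm_toEuclideanLin_le A v
  · exact norm_le_of_forall_toEuclideanLin (LinearMap.singularValues_nonneg _ _)
      (norm_apply_le_singularValues_zero _)

theorem sigmaMin_pos [Nonempty n] {A : Matrix m n ℝ} (hA : LinearIndependent ℝ A.col) :
    0 < sigmaMin A := by
  refine (sigmaMin_nonneg A).lt_of_ne fun h => ?_
  obtain ⟨v, hv, h2⟩ := exists_norm_eq_sigmaMin A
  rw [← h, norm_eq_zero] at h2
  have h3 : A.mulVec v.ofLp = 0 := by
    simpa [Matrix.toEuclideanLin, Matrix.toLpLin] using h2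
  have h4 := Matrix.mulVec_injective_iff.2 hA (h3.trans (Matrix.mulVec_zero A).symm)
  have h5 : v = 0 := by ext i; simpa using congrFun h4 i
  simp [h5] at hv

theorem sigmaMin_le_norm [Nonempty n] (A : Matrix m n ℝ) : sigmaMin A ≤ ‖A‖ := by
  obtain ⟨v, hv, h⟩ := exists_norm_eq_sigmaMin A
  rw [← h]
  simpa [hv] using norm_toEuclideanLin_le A v

theorem one_le_condNum [Nonempty n] {A : Matrix m n ℝ} (hA : LinearIndependent ℝ A.col) :
    1 ≤ condNum A := by
  rw [condNum_eq, one_le_div (sigmaMin_pos hA)]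
  exact sigmaMin_le_norm A

theorem linearIndependent_submatrix_cols {A : Matrix m n ℝ} (hA : LinearIndependent ℝ A.col)
    {f : α → n} (hf : Function.Injective f) : LinearIndependent ℝ (A.submatrix id f).col :=
  hA.comp f hf

/-- A minimizing unit vector of the submatrix, extended by zeros through the isometry `J`, is a test
vector for `A`. -/
theorem sigmaMin_le_submatrix_cols [Nonempty α] (A : Matrix m n ℝ) {f : α → n}
    (hf : Function.Injective f) : sigmaMin A ≤ sigmaMin (A.submatrix id f) := by
  obtain ⟨v, hv, h⟩ := exists_norm_eq_sigmaMin (A.submatrix id f)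
  set J := (1 : Matrix n n ℝ).submatrix id f
  have hJ : Jᵀ * J = 1 := by
    ext i j
    simp [J, Matrix.mul_apply, Matrix.one_apply, hf.eq_iff]
  have h1 : Matrix.toEuclideanLin (A.submatrix id f) v
      = Matrix.toEuclideanLin A (Matrix.toEuclideanLin J v) := by
    rw [submatrix_id_eq_mul]
    simp [Matrix.toEuclideanLin, Matrix.toLpLin, J]
  have h2 : ‖v‖ ≤ ‖Matrix.toEuclideanLin J v‖ := by
    have : Matrix.toEuclideanLin Jᵀ (Matrix.toEuclideanLin J v) = v := by
      simp [Matrix.toEuclideanLin, Matrix.toLpLin, hJ]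
    calc ‖v‖ = ‖Matrix.toEuclideanLin Jᵀ (Matrix.toEuclideanLin J v)‖ := by rw [this]
      _ ≤ ‖Jᵀ‖ * ‖Matrix.toEuclideanLin J v‖ := norm_toEuclideanLin_le _ _
      _ ≤ 1 * ‖Matrix.toEuclideanLin J v‖ := by
        gcongr
        rw [norm_transpose]
        exact norm_one_submatrix_le hf
      _ = _ := one_mul _
  rw [← h, h1]
  calc sigmaMin A = sigmaMin A * ‖v‖ := by rw [hv, mul_one]
    _ ≤ sigmaMin A * ‖Matrix.toEuclideanLin J v‖ := by
      gcongr
      exact sigmaMin_nonneg A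
    _ ≤ _ := sigmaMin_mul_le _ _

theorem condNum_submatrix_cols_le [Nonempty α] [Nonempty n] {A : Matrix m n ℝ}
    (hA : LinearIndependent ℝ A.col) {f : α → n} (hf : Function.Injective f) :
    condNum (A.submatrix id f) ≤ condNum A := by
  rw [condNum_eq, condNum_eq]
  exact div_le_div₀ (norm_nonneg _) (norm_submatrix_cols_le A hf) (sigmaMin_pos hA)
    (sigmaMin_le_submatrix_cols A hf)

end CondNum

/-! ### Accurate factorizations have bounded factors and nearly orthonormal bases. -/

section WellConditioned

variable {m n : Type*} [Fintype m] [Fintype n] [DecidableEq m] [DecidableEq n]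

theorem norm_sq_toEuclideanLin (A : Matrix m n ℝ) (v : EuclideanSpace ℝ n) :
    ‖Matrix.toEuclideanLin A v‖ ^ 2 = inner ℝ (Matrix.toEuclideanLin (Aᵀ * A) v) v := by
  have h1 : Matrix.toEuclideanLin (Aᵀ * A) v
      = Matrix.toEuclideanLin Aᵀ (Matrix.toEuclideanLin A v) := by
    simp [Matrix.toEuclideanLin, Matrix.toLpLin]
  rw [h1, ← Matrix.conjTranspose_eq_transpose_of_trivial,
    Matrix.toEuclideanLin_conjTranspose_eq_adjoint, LinearMap.adjoint_inner_left,
    real_inner_self_eq_norm_sq]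

theorem norm_sq_sub_norm_sq_le (A : Matrix m n ℝ) {l : Type*} [Fintype l] [DecidableEq l]
    (B : Matrix l n ℝ) (v : EuclideanSpace ℝ n) :
    ‖Matrix.toEuclideanLin B v‖ ^ 2 - ‖Matrix.toEuclideanLin A v‖ ^ 2
      ≤ ‖Aᵀ * A - Bᵀ * B‖ * ‖v‖ ^ 2 := by
  rw [norm_sq_toEuclideanLin, norm_sq_toEuclideanLin, ← inner_sub_left, ← LinearMap.sub_apply,
    ← map_sub]
  refine (real_inner_le_norm _ _).trans ?_
  rw [sq, ← mul_assoc]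
  gcongr
  rw [norm_sub_rev (Aᵀ * A)]
  exact norm_toEuclideanLin_le (Bᵀ * B - Aᵀ * A) v

/-- If `RᵀR` is close to `XᵀX`, then `R` is invertible, and its inverse is controlled by the
smallest singular value of `X`. -/
theorem exists_inverse_of_gram_close [Nonempty n] {X : Matrix m n ℝ} {R : Matrix n n ℝ} {a : ℝ}
    (hX : LinearIndependent ℝ X.col) (ha : a < 1)
    (h : ‖Rᵀ * R - Xᵀ * X‖ ≤ a * sigmaMin X ^ 2) :
    ∃ Y : Matrix n n ℝ, R * Y = 1 ∧ Y * R = 1 ∧ ‖Y‖ ^ 2 * ((1 - a) * sigmaMin X ^ 2) ≤ 1 := by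
  have hσ := sigmaMin_pos hX
  -- The quadratic forms of the two Gram matrices differ by at most `a * sigmaMin X ^ 2 * ‖v‖ ^ 2`.
  -- This lower bound gives both injectivity of `R` and the size of its inverse.
  have low : ∀ v, (1 - a) * sigmaMin X ^ 2 * ‖v‖ ^ 2 ≤ ‖Matrix.toEuclideanLin R v‖ ^ 2 := by
    intro v
    have h1 := norm_sq_sub_norm_sq_le R X v
    have h2 := pow_le_pow_left₀ (mul_nonneg hσ.le (norm_nonneg v)) (sigmaMin_mul_le X v) 2
    have h3 := mul_le_mul_of_nonneg_right h (sq_nonneg ‖v‖)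
    nlinarith
  set c := (1 - a) * sigmaMin X ^ 2 with hc
  have hc0 : 0 < c := mul_pos (by linarith) (pow_pos hσ 2)
  have inj : Function.Injective R.mulVec := by
    rw [← Matrix.coe_mulVecLin, ← LinearMap.ker_eq_bot, LinearMap.ker_eq_bot']
    intro v hv
    have h1 := low (WithLp.toLp 2 v)
    have h2 : Matrix.toEuclideanLin R (WithLp.toLp 2 v) = 0 := by
      simpa [Matrix.toEuclideanLin, Matrix.toLpLin] using hv
    rw [h2, norm_zero] at h1
    have h3 : ‖(WithLp.toLp 2 v : EuclideanSpace ℝ n)‖ = 0 := by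
      by_contra h4
      have := (norm_nonneg (WithLp.toLp 2 v : EuclideanSpace ℝ n)).lt_of_ne (Ne.symm h4)
      have := mul_pos hc0 (pow_pos this 2)
      linarith
    simpa using h3
  have hu : IsUnit R := Matrix.mulVec_injective_iff_isUnit.1 inj
  have hd := (Matrix.isUnit_iff_isUnit_det R).1 hu
  refine ⟨R⁻¹, Matrix.mul_nonsing_inv R hd, Matrix.nonsing_inv_mul R hd, ?_⟩
  have h5 : ‖R⁻¹‖ ≤ 1 / √c := by
    refine norm_le_of_forall_toEuclideanLin (by positivity) fun w => ?_
    have h6 := low (Matrix.toEuclideanLin R⁻¹ w)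
    have h7 : Matrix.toEuclideanLin R (Matrix.toEuclideanLin R⁻¹ w) = w := by
      simp [Matrix.toEuclideanLin, Matrix.toLpLin, Matrix.mul_nonsing_inv R hd]
    rw [h7] at h6
    rw [one_div, ← div_eq_inv_mul, le_div_iff₀ (Real.sqrt_pos.2 hc0)]
    refine le_of_sq_le_sq ?_ (norm_nonneg _)
    rw [mul_pow, Real.sq_sqrt hc0.le]
    linarith
  calc ‖R⁻¹‖ ^ 2 * c ≤ (1 / √c) ^ 2 * c := by gcongr
    _ = 1 := by
      rw [div_pow, Real.sq_sqrt hc0.le]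
      field_simp

theorem norm_sq_le_of_gram_close {l : Type*} [Fintype l] [DecidableEq l] {X : Matrix m n ℝ}
    {R : Matrix l n ℝ} {c : ℝ} (h : ‖Rᵀ * R - Xᵀ * X‖ ≤ c) : ‖R‖ ^ 2 ≤ ‖X‖ ^ 2 + c := by
  rw [← norm_transpose_mul_self, ← norm_transpose_mul_self]
  have := norm_le_norm_add_norm_sub' (Rᵀ * R) (Xᵀ * X)
  linarith

/-- The exact basis `XY` belonging to the computed `R` is nearly orthonormal: its Gram matrix is `1
- Yᵀ(RᵀR - XᵀX)Y`. -/
theorem norm_sq_mul_inverse_le {X : Matrix m n ℝ} {R Y : Matrix n n ℝ} (hRY : R * Y = 1) :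
    ‖X * Y‖ ^ 2 ≤ 1 + ‖Rᵀ * R - Xᵀ * X‖ * ‖Y‖ ^ 2 := by
  have h : (X * Y)ᵀ * (X * Y) = 1 - Yᵀ * (Rᵀ * R - Xᵀ * X) * Y := by
    have h1 : Yᵀ * (Rᵀ * R) * Y = 1 := by
      rw [Matrix.mul_assoc, Matrix.mul_assoc, hRY, Matrix.mul_one, ← Matrix.transpose_mul, hRY,
        Matrix.transpose_one]
    rw [Matrix.mul_sub, Matrix.sub_mul, h1, Matrix.transpose_mul]
    simp only [Matrix.mul_assoc]
    abel
  rw [← norm_transpose_mul_self, h]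
  refine (norm_sub_le _ _).trans (add_le_add norm_one_le ?_)
  calc ‖Yᵀ * (Rᵀ * R - Xᵀ * X) * Y‖ ≤ ‖Yᵀ‖ * ‖Rᵀ * R - Xᵀ * X‖ * ‖Y‖ :=
        (norm_mul_le' _ _).trans (by gcongr; exact norm_mul_le' _ _)
    _ = _ := by rw [norm_transpose]; ring

/-- The computed basis is bounded if the computed factorization is accurate enough relative to the
condition number. -/
theorem norm_basis_mul_le [Nonempty n] {X Q : Matrix m n ℝ} {R : Matrix n n ℝ}
    (hX : LinearIndependent ℝ X.col) {ξ ρ a b w y z : ℝ}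
    (ha0 : 0 ≤ a) (ha : a < 1) (hρ : 0 ≤ ρ)
    (hE : ‖Rᵀ * R - Xᵀ * X‖ ≤ ξ * ‖X‖ ^ 2) (hξ : ξ * ‖X‖ ^ 2 ≤ a * sigmaMin X ^ 2)
    (hD : ‖Q * R - X‖ ≤ ρ * (‖X‖ + ‖Q‖ * ‖R‖)) (hb : ρ * ‖X‖ ^ 2 ≤ b * sigmaMin X ^ 2)
    (hw : 1 ≤ w ^ 2 * (1 - a)) (hw0 : 0 ≤ w) (hy : 1 + a ≤ y ^ 2) (hy0 : 0 ≤ y)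
    (hz : 1 + a * w ^ 2 ≤ z ^ 2) (hz0 : 0 ≤ z) :
    ‖R‖ ≤ y * ‖X‖ ∧ ‖Q‖ * (1 - b * w * y) ≤ z + b * w := by
  -- The parameters `w`, `y`, `z` are upper bounds for `(1 - a)^(-1/2)`, `(1 + a)^(1/2)` and `(1 + a
  -- w²)^(1/2)`. They bound `‖Y‖ * sigmaMin X`, `‖R‖ / ‖X‖` and `‖X * Y‖`, and can be chosen
  -- rational.
  have hσ := sigmaMin_pos hX
  have hσX := sigmaMin_le_norm X
  set σ := sigmaMin X
  obtain ⟨Y, hRY, -, hY⟩ := exists_inverse_of_gram_close hX ha (hE.trans hξ)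
  have hYn := norm_nonneg Y
  have hXn := norm_nonneg X
  have hQn := norm_nonneg Q
  have hσX2 := pow_le_pow_left₀ hσ.le hσX 2
  have hR : ‖R‖ ≤ y * ‖X‖ := by
    refine le_of_sq_le_sq ?_ (by positivity)
    have := norm_sq_le_of_gram_close (hE.trans hξ)
    rw [mul_pow]
    nlinarith
  refine ⟨hR, ?_⟩
  have hYσ : ‖Y‖ * σ ≤ w := by
    refine le_of_sq_le_sq ?_ hw0
    have h1 : (‖Y‖ * σ) ^ 2 * (1 - a) ≤ w ^ 2 * (1 - a) := by linarith [hY, mul_pow ‖Y‖ σ 2]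
    exact le_of_mul_le_mul_right h1 (by linarith)
  have hXY : ‖X * Y‖ ≤ z := by
    refine le_of_sq_le_sq (le_trans ?_ hz) hz0
    refine (norm_sq_mul_inverse_le hRY).trans ?_
    have h1 := mul_le_mul_of_nonneg_right (hE.trans hξ) (sq_nonneg ‖Y‖)
    have h2 := pow_le_pow_left₀ (by positivity) hYσ 2
    nlinarith
  have hQ : Q = X * Y + (Q * R - X) * Y := by
    rw [Matrix.sub_mul, Matrix.mul_assoc, hRY, Matrix.mul_one]
    abel
  have hb' : ρ * ‖X‖ ≤ b * σ := by
    have : ρ * ‖X‖ * σ ≤ b * σ * σ := by nlinarith [mul_nonneg hρ hXn]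
    exact le_of_mul_le_mul_right this hσ
  have hb0 : 0 ≤ b := by
    have : 0 ≤ b * σ := (mul_nonneg hρ hXn).trans hb'
    exact nonneg_of_mul_nonneg_left this hσ
  have hDY : ‖(Q * R - X) * Y‖ ≤ b * w * (1 + ‖Q‖ * y) := by
    calc ‖(Q * R - X) * Y‖ ≤ ‖Q * R - X‖ * ‖Y‖ := norm_mul_le' _ _
      _ ≤ (ρ * (‖X‖ + ‖Q‖ * (y * ‖X‖))) * ‖Y‖ := by
        gcongr
        exact hD.trans (by gcongr)
      _ = (ρ * ‖X‖) * ‖Y‖ * (1 + ‖Q‖ * y) := by ring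
      _ ≤ (b * σ) * ‖Y‖ * (1 + ‖Q‖ * y) := by gcongr
      _ = b * (‖Y‖ * σ) * (1 + ‖Q‖ * y) := by ring
      _ ≤ _ := by gcongr
  -- The residual bound contains `‖Q‖` itself, so this is an implicit inequality, to be solved when
  -- `b * w * y < 1`.
  have h3 : ‖Q‖ ≤ z + b * w * (1 + ‖Q‖ * y) := by
    conv_lhs => rw [hQ]
    exact (norm_add_le _ _).trans (add_le_add hXY hDY)
  linarith

/-- For blocks before the last, where smallness leaves extra room. The bound 1.4 keeps the basis
below the norm 2 needed by the rounding analysis. -/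
theorem norm_basis_le_of_strong [Nonempty n] {X Q : Matrix m n ℝ} {R : Matrix n n ℝ}
    (hX : LinearIndependent ℝ X.col) {ξ ρ : ℝ} (hρ : 0 ≤ ρ)
    (hE : ‖Rᵀ * R - Xᵀ * X‖ ≤ ξ * ‖X‖ ^ 2) (hξ : ξ * ‖X‖ ^ 2 ≤ 1 / 4 * sigmaMin X ^ 2)
    (hD : ‖Q * R - X‖ ≤ ρ * (‖X‖ + ‖Q‖ * ‖R‖)) (hb : ρ * ‖X‖ ^ 2 ≤ 1 / 28 * sigmaMin X ^ 2) :
    ‖R‖ ≤ 1.12 * ‖X‖ ∧ ‖Q‖ ≤ 1.4 := by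
  obtain ⟨h1, h2⟩ := norm_basis_mul_le hX (w := 1.16) (y := 1.12) (z := 1.16) (by norm_num)
    (by norm_num) hρ hE hξ hD hb (by norm_num) (by norm_num) (by norm_num) (by norm_num)
    (by norm_num) (by norm_num)
  exact ⟨h1, by linarith⟩

/-- Also covers the last block, with only the thresholds that the smallness assumption states
directly. -/
theorem norm_basis_le_of_weak [Nonempty n] {X Q : Matrix m n ℝ} {R : Matrix n n ℝ}
    (hX : LinearIndependent ℝ X.col) {ξ ρ : ℝ} (hρ : 0 ≤ ρ)
    (hE : ‖Rᵀ * R - Xᵀ * X‖ ≤ ξ * ‖X‖ ^ 2) (hξ : ξ * ‖X‖ ^ 2 ≤ 1 / 2 * sigmaMin X ^ 2)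
    (hD : ‖Q * R - X‖ ≤ ρ * (‖X‖ + ‖Q‖ * ‖R‖)) (hb : ρ * ‖X‖ ^ 2 ≤ 1 / 4 * sigmaMin X ^ 2) :
    ‖R‖ ≤ 1.25 * ‖X‖ ∧ ‖Q‖ ≤ 4 := by
  obtain ⟨h1, h2⟩ := norm_basis_mul_le hX (w := 1.42) (y := 1.25) (z := 1.42) (by norm_num)
    (by norm_num) hρ hE hξ hD hb (by norm_num) (by norm_num) (by norm_num) (by norm_num)
    (by norm_num) (by norm_num)
  exact ⟨h1, by linarith⟩

/-- Loss of orthogonality in terms of the errors of the factorization. -/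
theorem norm_one_sub_gram_le [Nonempty n] {X Q : Matrix m n ℝ} {R : Matrix n n ℝ}
    (hX : LinearIndependent ℝ X.col) {μ ν : ℝ}
    (hE : ‖Rᵀ * R - Xᵀ * X‖ ≤ μ * ‖X‖ ^ 2) (hE' : ‖Rᵀ * R - Xᵀ * X‖ ≤ 1 / 2 * sigmaMin X ^ 2)
    (hD : ‖Q * R - X‖ ≤ ν * ‖X‖) (hD' : ‖Q * R - X‖ ≤ 2 * ‖X‖) :
    ‖1 - Qᵀ * Q‖ ≤ 2 * (μ + 4 * ν) * condNum X ^ 2 := by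
  have hσ := sigmaMin_pos hX
  have hXn : 0 < ‖X‖ := hσ.trans_le (sigmaMin_le_norm X)
  obtain ⟨Y, hRY, -, hY⟩ := exists_inverse_of_gram_close hX (by norm_num) hE'
  have hμ : 0 ≤ μ := nonneg_of_mul_nonneg_left ((norm_nonneg _).trans hE) (by positivity)
  have hν : 0 ≤ ν := nonneg_of_mul_nonneg_left ((norm_nonneg _).trans hD) hXn
  set D := Q * R - X with hDdef
  set E := Rᵀ * R - Xᵀ * X with hEdef
  -- Substituting `QR = X + D` into `Rᵀ(1 - QᵀQ)R = RᵀR - (QR)ᵀ(QR)`. The crude bound `‖D‖ ≤ 2‖X‖`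
  -- then absorbs the quadratic term into the linear ones, giving `μ + 4ν`.
  have key : 1 - Qᵀ * Q = Yᵀ * (E - Dᵀ * X - Xᵀ * D - Dᵀ * D) * Y := by
    have h1 : E - Dᵀ * X - Xᵀ * D - Dᵀ * D = Rᵀ * (1 - Qᵀ * Q) * R := by
      have h2 : Rᵀ * (1 - Qᵀ * Q) * R = Rᵀ * R - (Q * R)ᵀ * (Q * R) := by
        rw [Matrix.mul_sub, Matrix.sub_mul, Matrix.mul_one, Matrix.transpose_mul]
        simp only [Matrix.mul_assoc]
      have h3 : Q * R = D + X := by rw [hDdef, sub_add_cancel]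
      rw [h2, h3, Matrix.transpose_add, Matrix.add_mul, Matrix.mul_add, Matrix.mul_add, hEdef]
      abel
    rw [h1]
    have h3 : Yᵀ * Rᵀ = 1 := by rw [← Matrix.transpose_mul, hRY, Matrix.transpose_one]
    simp only [← Matrix.mul_assoc]
    rw [h3, Matrix.one_mul, Matrix.mul_assoc, hRY, Matrix.mul_one]
  have hF : ‖E - Dᵀ * X - Xᵀ * D - Dᵀ * D‖ ≤ (μ + 4 * ν) * ‖X‖ ^ 2 := by
    have h1 : ‖Dᵀ * X‖ ≤ ‖D‖ * ‖X‖ := (norm_mul_le' _ _).trans_eq (by rw [norm_transpose])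
    have h2 : ‖Xᵀ * D‖ ≤ ‖X‖ * ‖D‖ := (norm_mul_le' _ _).trans_eq (by rw [norm_transpose])
    have h3 := norm_transpose_mul_self D
    have h4 := norm_sub_le (E - Dᵀ * X - Xᵀ * D) (Dᵀ * D)
    have h5 := norm_sub_le (E - Dᵀ * X) (Xᵀ * D)
    have h6 := norm_sub_le E (Dᵀ * X)
    have h7 := mul_le_mul_of_nonneg_right hD hXn.le
    have h8 : ‖D‖ ^ 2 ≤ (2 * ‖X‖) * (ν * ‖X‖) := by
      rw [sq]; exact mul_le_mul hD' hD (norm_nonneg _) (by positivity)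
    nlinarith
  have h9 : ‖Y‖ ^ 2 ≤ 2 / sigmaMin X ^ 2 := by
    rw [le_div_iff₀ (by positivity)]; linarith
  rw [key, condNum_eq]
  calc ‖Yᵀ * (E - Dᵀ * X - Xᵀ * D - Dᵀ * D) * Y‖
      ≤ ‖Yᵀ‖ * ‖E - Dᵀ * X - Xᵀ * D - Dᵀ * D‖ * ‖Y‖ :=
        (norm_mul_le' _ _).trans (by gcongr; exact norm_mul_le' _ _)
    _ = ‖E - Dᵀ * X - Xᵀ * D - Dᵀ * D‖ * ‖Y‖ ^ 2 := by rw [norm_transpose]; ring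
    _ ≤ (μ + 4 * ν) * ‖X‖ ^ 2 * (2 / sigmaMin X ^ 2) := by gcongr
    _ = _ := by rw [div_pow]; ring

end WellConditioned

/-! ### Appending one block column to the factorization. -/

section Blocks

variable {m p s : ℕ}

theorem inclBlk_injective {p k : ℕ} (s : ℕ) (hk : k ≤ p) : Function.Injective (inclBlk s hk) := by
  rintro ⟨a, b⟩ ⟨c, d⟩ h
  simp only [inclBlk, Prod.mk.injEq] at h
  exact Prod.ext (Fin.castLE_injective hk h.1) h.2

theorem mk_injective {p s : ℕ} (k : Fin p) : Function.Injective (fun j : Fin s => (k, j)) :=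
  fun _ _ h => (Prod.ext_iff.1 h).2

/-- The indices of the first `k + 1` blocks are those of the first `k` blocks and of block `k`. -/
theorem bijective_sum_elim_inclBlk (k s : ℕ) :
    Function.Bijective (Sum.elim (inclBlk s (Nat.le_succ k))
      (fun j : Fin s => (Fin.last k, j))) := by
  constructor
  · refine Function.Injective.sumElim (inclBlk_injective s _) (mk_injective _) ?_
    rintro ⟨a, b⟩ c h
    have h1 := congrArg (fun x => (x.1 : ℕ)) h
    simp [inclBlk] at h1
    omega
  · rintro ⟨i, j⟩
    induction i using Fin.lastCases with
    | last => exact ⟨Sum.inr j, rfl⟩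
    | cast i => exact ⟨Sum.inl (i, j), rfl⟩

theorem norm_lead_le_of_le (X : Matrix (Fin m) (Fin p × Fin s) ℝ) {k l : ℕ} (hkl : k ≤ l)
    (hl : l ≤ p) : ‖lead X (hkl.trans hl)‖ ≤ ‖lead X hl‖ := by
  have h : lead X (hkl.trans hl) = (lead X hl).submatrix id (inclBlk s hkl) := rfl
  rw [h]
  exact norm_submatrix_cols_le (lead X hl) (inclBlk_injective s hkl)

theorem norm_blk_le_norm_lead (X : Matrix (Fin m) (Fin p × Fin s) ℝ) {k : ℕ} (hk : k + 1 ≤ p) :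
    ‖blk X ⟨k, hk⟩‖ ≤ ‖lead X hk‖ := by
  have h : blk X ⟨k, hk⟩ = (lead X hk).submatrix id (fun j => (Fin.last k, j)) := rfl
  rw [h]
  exact norm_submatrix_cols_le (lead X hk) (mk_injective (Fin.last k))

theorem norm_diagBlk_le_norm_leadSq (R : Matrix (Fin p × Fin s) (Fin p × Fin s) ℝ) {k : ℕ}
    (hk : k + 1 ≤ p) : ‖diagBlk R ⟨k, hk⟩‖ ≤ ‖leadSq R hk‖ := by
  have h : diagBlk R ⟨k, hk⟩ = (leadSq R hk).submatrix (fun j => (Fin.last k, j))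
    (fun j => (Fin.last k, j)) := rfl
  rw [h]
  exact norm_submatrix_le (leadSq R hk) (mk_injective (Fin.last k)) (mk_injective (Fin.last k))

theorem norm_leadSq_le_of_le (R : Matrix (Fin p × Fin s) (Fin p × Fin s) ℝ) {k l : ℕ}
    (hkl : k ≤ l) (hl : l ≤ p) : ‖leadSq R (hkl.trans hl)‖ ≤ ‖leadSq R hl‖ := by
  have h : leadSq R (hkl.trans hl) = (leadSq R hl).submatrix (inclBlk s hkl) (inclBlk s hkl) := rfl
  rw [h]
  exact norm_submatrix_le (leadSq R hl) (inclBlk_injective s hkl) (inclBlk_injective s hkl)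

theorem linearIndependent_lead {X : Matrix (Fin m) (Fin p × Fin s) ℝ}
    (hX : LinearIndependent ℝ X.col) {k : ℕ} (hk : k ≤ p) :
    LinearIndependent ℝ (lead X hk).col :=
  linearIndependent_submatrix_cols hX (inclBlk_injective s hk)

theorem linearIndependent_blk {X : Matrix (Fin m) (Fin p × Fin s) ℝ}
    (hX : LinearIndependent ℝ X.col) (k : Fin p) : LinearIndependent ℝ (blk X k).col :=
  linearIndependent_submatrix_cols hX (mk_injective k)

variable {R : Matrix (Fin p × Fin s) (Fin p × Fin s) ℝ}

/-- The error of `RᵀR` for `k + 1` blocks, in terms of the error for `k` blocks. -/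
theorem norm_gram_sub_succ_le
    (hR : ∀ (i j : Fin p) (a b : Fin s), j < i → R (i, a) (j, b) = 0)
    (X : Matrix (Fin m) (Fin p × Fin s) ℝ) {k : ℕ} (hk : k + 1 ≤ p) :
    ‖(leadSq R hk)ᵀ * leadSq R hk - (lead X hk)ᵀ * lead X hk‖
      ≤ ‖(leadSq R (Nat.le_of_succ_le hk))ᵀ * leadSq R (Nat.le_of_succ_le hk)
          - (lead X (Nat.le_of_succ_le hk))ᵀ * lead X (Nat.le_of_succ_le hk)‖
        + 2 * ‖(leadSq R (Nat.le_of_succ_le hk))ᵀ * above R ⟨k, hk⟩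
            - (lead X (Nat.le_of_succ_le hk))ᵀ * blk X ⟨k, hk⟩‖
        + ‖(above R ⟨k, hk⟩)ᵀ * above R ⟨k, hk⟩ + (diagBlk R ⟨k, hk⟩)ᵀ * diagBlk R ⟨k, hk⟩
            - (blk X ⟨k, hk⟩)ᵀ * blk X ⟨k, hk⟩‖ := by
  set f := inclBlk s (Nat.le_succ k)
  set g : Fin s → Fin (k + 1) × Fin s := fun j => (Fin.last k, j)
  have hfg := bijective_sum_elim_inclBlk k s
  set A := leadSq R hk with hA
  set B := lead X hk with hB
  have h0 : A.submatrix g f = 0 := by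
    ext a ⟨i, b⟩
    refine hR _ _ _ _ ?_
    rw [Fin.lt_def]
    exact i.isLt
  have hA1 : A.submatrix f f = leadSq R (Nat.le_of_succ_le hk) := rfl
  have hA2 : A.submatrix f g = above R ⟨k, hk⟩ := rfl
  have hA3 : A.submatrix g g = diagBlk R ⟨k, hk⟩ := rfl
  have hB1 : B.submatrix id f = lead X (Nat.le_of_succ_le hk) := rfl
  have hB2 : B.submatrix id g = blk X ⟨k, hk⟩ := rfl
  have hAA : Aᵀ * A = (A.submatrix f id)ᵀ * A.submatrix f id
      + (A.submatrix g id)ᵀ * A.submatrix g id := mul_eq_add_of_bijective Aᵀ A hfg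
  have hff : (Aᵀ * A - Bᵀ * B).submatrix f f = (A.submatrix f f)ᵀ * A.submatrix f f
      - (B.submatrix id f)ᵀ * B.submatrix id f := by
    have : (Aᵀ * A - Bᵀ * B).submatrix f f = (A.submatrix f f)ᵀ * A.submatrix f f
      + (A.submatrix g f)ᵀ * A.submatrix g f - (B.submatrix id f)ᵀ * B.submatrix id f := by
      rw [hAA]; rfl
    rw [this, h0]
    simp
  have hfg' : (Aᵀ * A - Bᵀ * B).submatrix f g = (A.submatrix f f)ᵀ * A.submatrix f g
      - (B.submatrix id f)ᵀ * B.submatrix id g := by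
    have : (Aᵀ * A - Bᵀ * B).submatrix f g = (A.submatrix f f)ᵀ * A.submatrix f g
      + (A.submatrix g f)ᵀ * A.submatrix g g - (B.submatrix id f)ᵀ * B.submatrix id g := by
      rw [hAA]; rfl
    rw [this, h0]
    simp
  have hgg : (Aᵀ * A - Bᵀ * B).submatrix g g = (A.submatrix f g)ᵀ * A.submatrix f g
      + (A.submatrix g g)ᵀ * A.submatrix g g - (B.submatrix id g)ᵀ * B.submatrix id g := by
    rw [hAA]; rfl
  -- By symmetry the two off-diagonal blocks contribute equally, whence the factor 2.
  have hgf : ‖(Aᵀ * A - Bᵀ * B).submatrix g f‖ = ‖(Aᵀ * A - Bᵀ * B).submatrix f g‖ := by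
    rw [← norm_transpose, Matrix.transpose_submatrix]
    simp [Matrix.transpose_sub, Matrix.transpose_mul]
  have h := norm_le_add_of_bijective (Aᵀ * A - Bᵀ * B) hfg
  rw [hgf, hff, hfg', hgg, hA1, hA2, hA3, hB1, hB2] at h
  linarith

/-- The residual for `k + 1` blocks, in terms of the residual for `k` blocks. -/
theorem norm_residual_succ_le
    (hR : ∀ (i j : Fin p) (a b : Fin s), j < i → R (i, a) (j, b) = 0)
    (Q X : Matrix (Fin m) (Fin p × Fin s) ℝ) {k : ℕ} (hk : k + 1 ≤ p) :
    ‖lead Q hk * leadSq R hk - lead X hk‖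
      ≤ ‖lead Q (Nat.le_of_succ_le hk) * leadSq R (Nat.le_of_succ_le hk)
          - lead X (Nat.le_of_succ_le hk)‖
        + ‖lead Q (Nat.le_of_succ_le hk) * above R ⟨k, hk⟩
            + blk Q ⟨k, hk⟩ * diagBlk R ⟨k, hk⟩ - blk X ⟨k, hk⟩‖ := by
  set f := inclBlk s (Nat.le_succ k)
  set g : Fin s → Fin (k + 1) × Fin s := fun j => (Fin.last k, j)
  have hfg := bijective_sum_elim_inclBlk k s
  have h0 : (leadSq R hk).submatrix g f = 0 := by
    ext a ⟨i, b⟩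
    refine hR _ _ _ _ ?_
    rw [Fin.lt_def]
    exact i.isLt
  have h := norm_le_add_of_bijective_cols (lead Q hk * leadSq R hk - lead X hk) hfg
  have hf : (lead Q hk * leadSq R hk - lead X hk).submatrix id f
      = lead Q (Nat.le_of_succ_le hk) * leadSq R (Nat.le_of_succ_le hk)
          - lead X (Nat.le_of_succ_le hk) := by
    have : (lead Q hk * leadSq R hk - lead X hk).submatrix id f
      = (lead Q hk).submatrix id f * (leadSq R hk).submatrix f f
        + (lead Q hk).submatrix id g * (leadSq R hk).submatrix g f
        - (lead X hk).submatrix id f := by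
      rw [mul_eq_add_of_bijective (lead Q hk) (leadSq R hk) hfg]; rfl
    rw [this, h0, Matrix.mul_zero, add_zero]
    rfl
  have hg : (lead Q hk * leadSq R hk - lead X hk).submatrix id g
      = lead Q (Nat.le_of_succ_le hk) * above R ⟨k, hk⟩
            + blk Q ⟨k, hk⟩ * diagBlk R ⟨k, hk⟩ - blk X ⟨k, hk⟩ := by
    rw [mul_eq_add_of_bijective (lead Q hk) (leadSq R hk) hfg]; rfl
  rwa [hf, hg] at h

end Blocks

/-! ### Recursions for the Gram error and the residual. -/

section Steps

variable {m p s : ℕ}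

/-- The bounds for the errors in the processing of a single block. -/
structure StepBounds (e : ErrConsts) (X : Matrix (Fin m) (Fin p × Fin s) ℝ) (t : Trace m p s)
    (k : Fin p) : Prop where
  firstChol : (k : ℕ) = 0 →
    ‖(diagBlk t.R k)ᵀ * diagBlk t.R k - (blk X k)ᵀ * blk X k‖ ≤ e.ξ₁ * ‖blk X k‖ ^ 2
  firstRes : (k : ℕ) = 0 →
    ‖blk t.Q k * diagBlk t.R k - blk X k‖ ≤
      e.ρ₁ * (‖blk X k‖ + ‖blk t.Q k‖ * ‖diagBlk t.R k‖)
  inner : 0 < (k : ℕ) →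
    ‖above t.R k - (lead t.Q k.isLt.le)ᵀ * blk X k‖ ≤ e.δQX * ‖blk X k‖
  gram : 0 < (k : ℕ) →
    ‖t.P k - (blk X k)ᵀ * blk X k‖ ≤ e.δXX * ‖blk X k‖ ^ 2
  pyth : 0 < (k : ℕ) →
    ‖t.H k - (t.P k - (above t.R k)ᵀ * above t.R k)‖ ≤ e.δRR * ‖blk X k‖ ^ 2
  chol : 0 < (k : ℕ) →
    ‖(diagBlk t.R k)ᵀ * diagBlk t.R k - t.H k‖ ≤ e.δchol * ‖blk X k‖ ^ 2
  proj : 0 < (k : ℕ) →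
    ‖t.V k - (blk X k - lead t.Q k.isLt.le * above t.R k)‖ ≤ e.δQR * ‖blk X k‖
  solve : 0 < (k : ℕ) →
    ‖blk t.Q k * diagBlk t.R k - t.V k‖ ≤ e.δQ * (‖blk t.Q k‖ * ‖diagBlk t.R k‖)

/-- All constants are nonnegative. -/
def ErrConsts.Nonneg (e : ErrConsts) : Prop :=
  0 ≤ e.ξ₁ ∧ 0 ≤ e.ρ₁ ∧ 0 ≤ e.δQX ∧ 0 ≤ e.δXX ∧ 0 ≤ e.δRR ∧ 0 ≤ e.δchol ∧
    0 ≤ e.δQR ∧ 0 ≤ e.δQ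

theorem ErrConsts.Bounds.stepBounds {e : ErrConsts} {X : Matrix (Fin m) (Fin p × Fin s) ℝ}
    {t : Trace m p s} (h : e.Bounds X t) (k : Fin p) : StepBounds e X t k :=
  ⟨h.firstChol k, h.firstRes k, h.inner k, h.gram k, h.pyth k, h.chol k, h.proj k, h.solve k⟩

theorem ErrConsts.Bounds.of_stepBounds {e : ErrConsts} {X : Matrix (Fin m) (Fin p × Fin s) ℝ}
    {t : Trace m p s} (h0 : e.Nonneg) (h : ∀ k, StepBounds e X t k) : e.Bounds X t :=
  ⟨h0, fun k => (h k).firstChol, fun k => (h k).firstRes, fun k => (h k).inner,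
    fun k => (h k).gram, fun k => (h k).pyth, fun k => (h k).chol, fun k => (h k).proj,
    fun k => (h k).solve⟩

variable {e : ErrConsts} {X : Matrix (Fin m) (Fin p × Fin s) ℝ} {t : Trace m p s}

/-- The error of `RᵀR` for the first `k` blocks. -/
def gramErr (X : Matrix (Fin m) (Fin p × Fin s) ℝ) (t : Trace m p s) {k : ℕ} (hk : k ≤ p) : ℝ :=
  ‖(leadSq t.R hk)ᵀ * leadSq t.R hk - (lead X hk)ᵀ * lead X hk‖

/-- The residual for the first `k` blocks. -/
def resErr (X : Matrix (Fin m) (Fin p × Fin s) ℝ) (t : Trace m p s) {k : ℕ} (hk : k ≤ p) : ℝ :=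
  ‖lead t.Q hk * leadSq t.R hk - lead X hk‖

/-- The recursion started from zero blocks, where every matrix with an empty index set drops out. -/
theorem gramErr_one_le (hR : ∀ (i j : Fin p) (a b : Fin s), j < i → t.R (i, a) (j, b) = 0)
    (hp : 0 + 1 ≤ p) (h : StepBounds e X t ⟨0, hp⟩) :
    gramErr X t hp ≤ e.ξ₁ * ‖blk X ⟨0, hp⟩‖ ^ 2 := by
  have h1 := norm_gram_sub_succ_le hR X hp
  have : IsEmpty (Fin 0 × Fin s) := inferInstance
  have : IsEmpty (Fin ((⟨0, hp⟩ : Fin p) : ℕ) × Fin s) := this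
  have h2 : (above t.R ⟨0, hp⟩)ᵀ * above t.R ⟨0, hp⟩ = 0 := by
    ext i j
    simp [Matrix.mul_apply]
  rw [h2, zero_add (Matrix.transpose _ * _),
    norm_eq_zero_of_isEmpty_left ((leadSq t.R (Nat.le_of_succ_le hp))ᵀ * _ - _),
    norm_eq_zero_of_isEmpty_left ((leadSq t.R (Nat.le_of_succ_le hp))ᵀ * above t.R ⟨0, hp⟩ - _)]
    at h1
  have h3 := h.firstChol rfl
  unfold gramErr
  linarith

theorem resErr_one_le (hR : ∀ (i j : Fin p) (a b : Fin s), j < i → t.R (i, a) (j, b) = 0)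
    (hp : 0 + 1 ≤ p) : resErr X t hp
      ≤ ‖blk t.Q ⟨0, hp⟩ * diagBlk t.R ⟨0, hp⟩ - blk X ⟨0, hp⟩‖ := by
  have h1 := norm_residual_succ_le hR t.Q X hp
  have : IsEmpty (Fin 0 × Fin s) := inferInstance
  have : IsEmpty (Fin ((⟨0, hp⟩ : Fin p) : ℕ) × Fin s) := this
  have h2 : lead t.Q (Nat.le_of_succ_le hp) * above t.R ⟨0, hp⟩ = 0 := by
    ext i j
    simp [Matrix.mul_apply]
  rw [h2, zero_add (blk _ _ * _), norm_eq_zero_of_isEmpty_right (_ - lead X (Nat.le_of_succ_le hp)),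
    zero_add (norm _)] at h1
  exact h1

theorem gramErr_succ_le (hR : ∀ (i j : Fin p) (a b : Fin s), j < i → t.R (i, a) (j, b) = 0)
    {k : ℕ} (hk0 : 0 < k) (hk : k + 1 ≤ p) (h : StepBounds e X t ⟨k, hk⟩) :
    gramErr X t hk ≤ gramErr X t (Nat.le_of_succ_le hk)
      + 2 * (resErr X t (Nat.le_of_succ_le hk) * ‖blk X ⟨k, hk⟩‖
        + ‖leadSq t.R (Nat.le_of_succ_le hk)‖ * (e.δQX * ‖blk X ⟨k, hk⟩‖))
      + (e.δXX + e.δchol + e.δRR) * ‖blk X ⟨k, hk⟩‖ ^ 2 := by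
  refine (norm_gram_sub_succ_le hR X hk).trans ?_
  refine add_le_add (add_le_add le_rfl ?_) ?_
  · gcongr
    set R := leadSq t.R (Nat.le_of_succ_le hk)
    set Q := lead t.Q (Nat.le_of_succ_le hk)
    set S := above t.R ⟨k, hk⟩
    set x := blk X ⟨k, hk⟩
    set L := lead X (Nat.le_of_succ_le hk)
    -- Exact identity: the off-diagonal error consists of the old residual and the error of the
    -- inner products. No orthogonality of `Q` enters.
    have h1 : Rᵀ * S - Lᵀ * x = (Q * R - L)ᵀ * x + Rᵀ * (S - Qᵀ * x) := by
      rw [Matrix.transpose_sub, Matrix.sub_mul, Matrix.mul_sub, Matrix.transpose_mul,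
        Matrix.mul_assoc]
      abel
    have h2 : ‖Rᵀ * S - Lᵀ * x‖ ≤ ‖(Q * R - L)ᵀ‖ * ‖x‖ + ‖Rᵀ‖ * ‖S - Qᵀ * x‖ := by
      rw [h1]
      exact (norm_add_le _ _).trans (add_le_add (norm_mul_le' _ _) (norm_mul_le' _ _))
    rw [norm_transpose, norm_transpose] at h2
    refine h2.trans (add_le_add le_rfl ?_)
    exact mul_le_mul_of_nonneg_left (h.inner hk0) (norm_nonneg _)
  · set S := above t.R ⟨k, hk⟩
    set x := blk X ⟨k, hk⟩
    set T := diagBlk t.R ⟨k, hk⟩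
    -- The Pythagorean step: the diagonal error telescopes through the computed `P` and `H`.
    have h1 : Sᵀ * S + Tᵀ * T - xᵀ * x = (t.P ⟨k, hk⟩ - xᵀ * x) + (Tᵀ * T - t.H ⟨k, hk⟩)
        + (t.H ⟨k, hk⟩ - (t.P ⟨k, hk⟩ - Sᵀ * S)) := by abel
    rw [h1]
    have h2 := norm_add₃_le (a := t.P ⟨k, hk⟩ - xᵀ * x) (b := Tᵀ * T - t.H ⟨k, hk⟩)
      (c := t.H ⟨k, hk⟩ - (t.P ⟨k, hk⟩ - Sᵀ * S))
    have h3 := h.gram hk0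
    have h4 := h.chol hk0
    have h5 := h.pyth hk0
    linarith

theorem resErr_succ_le (hR : ∀ (i j : Fin p) (a b : Fin s), j < i → t.R (i, a) (j, b) = 0)
    {k : ℕ} (hk0 : 0 < k) (hk : k + 1 ≤ p) (h : StepBounds e X t ⟨k, hk⟩) :
    resErr X t hk ≤ resErr X t (Nat.le_of_succ_le hk) + (e.δQR * ‖blk X ⟨k, hk⟩‖
      + e.δQ * (‖blk t.Q ⟨k, hk⟩‖ * ‖diagBlk t.R ⟨k, hk⟩‖)) := by
  refine (norm_residual_succ_le hR t.Q X hk).trans (add_le_add le_rfl ?_)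
  set S := above t.R ⟨k, hk⟩
  set x := blk X ⟨k, hk⟩
  set T := diagBlk t.R ⟨k, hk⟩
  have h1 : lead t.Q (Nat.le_of_succ_le hk) * S + blk t.Q ⟨k, hk⟩ * T - x
      = (t.V ⟨k, hk⟩ - (x - lead t.Q (Nat.le_of_succ_le hk) * S))
        + (blk t.Q ⟨k, hk⟩ * T - t.V ⟨k, hk⟩) := by abel
  rw [h1]
  exact (norm_add_le _ _).trans (add_le_add (h.proj hk0) (h.solve hk0))

end Steps

/-! ### Growth of `ρ_k` and `ξ_k`, and consequences of smallness. -/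

section Constants

variable {e : ErrConsts}

theorem ErrConsts.Nonneg.rho_nonneg (h : e.Nonneg) : ∀ k, 0 ≤ e.rho k
  | 0 => le_rfl
  | 1 => h.2.1
  | k + 2 => by
    have := h.rho_nonneg (k + 1)
    obtain ⟨h1, h2, h3, h4, h5, h6, h7, h8⟩ := h
    rw [ErrConsts.rho]; positivity

theorem ErrConsts.Nonneg.six_mul_rho_le (h : e.Nonneg) {k : ℕ} (hk : 0 < k) :
    6 * e.rho k ≤ e.rho (k + 1) := by
  obtain ⟨k, rfl⟩ := Nat.exists_eq_succ_of_ne_zero hk.ne'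
  obtain ⟨h1, h2, h3, h4, h5, h6, h7, h8⟩ := h
  simp only [ErrConsts.rho, Nat.succ_eq_add_one]
  linarith

theorem ErrConsts.Nonneg.rho_mono (h : e.Nonneg) : Monotone e.rho := by
  refine monotone_nat_of_le_succ fun k => ?_
  rcases Nat.eq_zero_or_pos k with rfl | hk
  · exact h.rho_nonneg 1
  · linarith [h.six_mul_rho_le hk, h.rho_nonneg k]

theorem ErrConsts.Nonneg.xi_mono (h : e.Nonneg) : Monotone e.xi := by
  refine monotone_nat_of_le_succ fun k => ?_
  have h0 := h.rho_nonneg k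
  obtain ⟨h1, h2, h3, h4, h5, h6, h7, h8⟩ := h
  rcases k with _ | k
  · exact h1
  · rw [ErrConsts.xi]
    have : 0 ≤ 2 * Real.sqrt 2 * e.δQX := by positivity
    linarith

theorem ErrConsts.Nonneg.xi_nonneg (h : e.Nonneg) (k : ℕ) : 0 ≤ e.xi k :=
  h.xi_mono (Nat.zero_le k)

theorem rho_le_rhoMax (e : ErrConsts) {p k : ℕ} (hk0 : 0 < k) (hk : k < p) :
    e.rho k ≤ e.rhoMax p := by
  have := le_ciSup (f := fun k : Fin (p - 1) => e.rho (k + 1)) (Set.finite_range _).bddAbove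
    ⟨k - 1, by omega⟩
  rwa [Nat.sub_add_cancel hk0] at this

theorem xi_le_xiMax (e : ErrConsts) {p k : ℕ} (hk0 : 0 < k) (hk : k < p) :
    e.xi k ≤ e.xiMax p := by
  have := le_ciSup (f := fun k : Fin (p - 1) => e.xi (k + 1)) (Set.finite_range _).bddAbove
    ⟨k - 1, by omega⟩
  rwa [Nat.sub_add_cancel hk0] at this

variable {m p s : ℕ} {X : Matrix (Fin m) (Fin p × Fin s) ℝ}

/-- Leading blocks are no worse conditioned than the whole matrix, so smallness against `condNum X`
becomes smallness against the least singular value of each leading part. -/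
theorem mul_norm_sq_lead_le (hX : LinearIndependent ℝ X.col) (hs : 0 < s) {k : ℕ} (hk0 : 0 < k)
    (hk : k ≤ p) {a b : ℝ} (ha : 0 ≤ a) (h : a * condNum X ^ 2 ≤ b) :
    a * ‖lead X hk‖ ^ 2 ≤ b * sigmaMin (lead X hk) ^ 2 := by
  have : Nonempty (Fin k × Fin s) := ⟨(⟨0, hk0⟩, ⟨0, hs⟩)⟩
  have : Nonempty (Fin p × Fin s) := ⟨(⟨0, hk0.trans_le hk⟩, ⟨0, hs⟩)⟩
  have hσ := sigmaMin_pos (linearIndependent_lead hX hk)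
  have h1 : condNum (lead X hk) ≤ condNum X := condNum_submatrix_cols_le hX (inclBlk_injective s hk)
  rw [condNum_eq (lead X hk)] at h1
  have h2 := pow_le_pow_left₀ (by positivity) h1 2
  have h3 := (mul_le_mul_of_nonneg_left h2 ha).trans h
  rw [div_pow, ← mul_div_assoc, div_le_iff₀ (by positivity)] at h3
  exact h3

theorem ErrConsts.Small.rho_xi_le (h0 : e.Nonneg) (h : e.Small X) {k : ℕ}
    (hk : k ≤ p) : e.rho k * condNum X ^ 2 ≤ 1 / 4 ∧ e.xi k * condNum X ^ 2 ≤ 1 / 2 := by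
  have h1 : 0 ≤ e.rhoMax p := Real.iSup_nonneg fun _ => h0.rho_nonneg _
  have h2 : 0 ≤ e.xiMax p := Real.iSup_nonneg fun _ => h0.xi_nonneg _
  have h3 := h0.rho_mono hk
  have h4 := h0.xi_mono hk
  exact ⟨le_trans (by gcongr; linarith) h.1, le_trans (by gcongr; linarith) h.2⟩

/-- For `k < p`, `ρ_k` is at most `ρ_max` and `6 ρ_k` at most `ρ_p`, so `7 ρ_k` is controlled by
1/4. Likewise `ξ_k` is below both `ξ_max` and `ξ_p`, so `2 ξ_k` is controlled by 1/2. The residual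
recursion itself would need only the coefficient 1 in place of 6. -/
theorem ErrConsts.Small.rho_xi_le_of_lt (h0 : e.Nonneg) (h : e.Small X) {k : ℕ} (hk0 : 0 < k)
    (hk : k < p) : e.rho k * condNum X ^ 2 ≤ 1 / 28 ∧ e.xi k * condNum X ^ 2 ≤ 1 / 4 := by
  have h1 := rho_le_rhoMax e hk0 hk
  have h2 := xi_le_xiMax e hk0 hk
  have h3 := (h0.six_mul_rho_le hk0).trans (h0.rho_mono (Nat.succ_le_of_lt hk))
  have h4 := h0.xi_mono hk.le
  have h5 : 7 * e.rho k * condNum X ^ 2 ≤ 1 / 4 := le_trans (by gcongr; linarith) h.1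
  have h6 : 2 * e.xi k * condNum X ^ 2 ≤ 1 / 2 := le_trans (by gcongr; linarith) h.2
  exact ⟨by linarith, by linarith⟩

end Constants

/-! ### Accuracy of leading blocks from the errors in the individual steps. -/

section Induction

variable {m p s : ℕ} {e : ErrConsts} {X : Matrix (Fin m) (Fin p × Fin s) ℝ} {t : Trace m p s}

/-- Away from the last block, accurate factorizations have well-conditioned factors. -/
theorem norm_lead_le_of_lt (hX : LinearIndependent ℝ X.col) (hs : 0 < s) (h0 : e.Nonneg)
    (h : e.Small X) {k : ℕ} (hk0 : 0 < k) (hk : k < p)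
    (hE : gramErr X t hk.le ≤ e.xi k * ‖lead X hk.le‖ ^ 2)
    (hD : resErr X t hk.le
      ≤ e.rho k * (‖lead X hk.le‖ + ‖lead t.Q hk.le‖ * ‖leadSq t.R hk.le‖)) :
    ‖leadSq t.R hk.le‖ ≤ 1.12 * ‖lead X hk.le‖ ∧ ‖lead t.Q hk.le‖ ≤ 1.4 := by
  have : Nonempty (Fin k × Fin s) := ⟨(⟨0, hk0⟩, ⟨0, hs⟩)⟩
  obtain ⟨h1, h2⟩ := h.rho_xi_le_of_lt h0 hk0 hk
  exact norm_basis_le_of_strong (linearIndependent_lead hX hk.le) (h0.rho_nonneg k) hE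
    (mul_norm_sq_lead_le hX hs hk0 hk.le (h0.xi_nonneg k) h2) hD
    (mul_norm_sq_lead_le hX hs hk0 hk.le (h0.rho_nonneg k) h1)

theorem norm_lead_le_of_le' (hX : LinearIndependent ℝ X.col) (hs : 0 < s) (h0 : e.Nonneg)
    (h : e.Small X) {k : ℕ} (hk0 : 0 < k) (hk : k ≤ p)
    (hE : gramErr X t hk ≤ e.xi k * ‖lead X hk‖ ^ 2)
    (hD : resErr X t hk
      ≤ e.rho k * (‖lead X hk‖ + ‖lead t.Q hk‖ * ‖leadSq t.R hk‖)) :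
    ‖leadSq t.R hk‖ ≤ 1.25 * ‖lead X hk‖ ∧ ‖lead t.Q hk‖ ≤ 4 := by
  have : Nonempty (Fin k × Fin s) := ⟨(⟨0, hk0⟩, ⟨0, hs⟩)⟩
  obtain ⟨h1, h2⟩ := h.rho_xi_le h0 hk
  exact norm_basis_le_of_weak (linearIndependent_lead hX hk) (h0.rho_nonneg k) hE
    (mul_norm_sq_lead_le hX hs hk0 hk (h0.xi_nonneg k) h2) hD
    (mul_norm_sq_lead_le hX hs hk0 hk (h0.rho_nonneg k) h1)

/-- The accuracy of the factorization of the first `k` blocks. -/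
theorem gramErr_resErr_le (hR : ∀ (i j : Fin p) (a b : Fin s), j < i → t.R (i, a) (j, b) = 0)
    (hX : LinearIndependent ℝ X.col) (hs : 0 < s) (h0 : e.Nonneg) (h : e.Small X) {k : ℕ}
    (hk0 : 1 ≤ k) (hk : k ≤ p) (hstep : ∀ j : Fin p, (j : ℕ) < k → StepBounds e X t j) :
    gramErr X t hk ≤ e.xi k * ‖lead X hk‖ ^ 2 ∧
      resErr X t hk ≤ e.rho k * (‖lead X hk‖ + ‖lead t.Q hk‖ * ‖leadSq t.R hk‖) := by
  induction k, hk0 using Nat.le_induction with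
  | base =>
    have hb := norm_blk_le_norm_lead X hk
    have hq := norm_blk_le_norm_lead t.Q hk
    have hr := norm_diagBlk_le_norm_leadSq t.R hk
    have h1 := hstep ⟨0, hk⟩ one_pos
    constructor
    · refine (gramErr_one_le hR hk h1).trans ?_
      exact mul_le_mul_of_nonneg_left (pow_le_pow_left₀ (norm_nonneg _) hb 2) h0.1
    · refine (resErr_one_le hR hk).trans ((h1.firstRes rfl).trans ?_)
      refine mul_le_mul_of_nonneg_left ?_ h0.2.1
      exact add_le_add hb (mul_le_mul hq hr (norm_nonneg _) (norm_nonneg _))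
  | succ k hk1 ih =>
    have hk' : k < p := hk
    obtain ⟨hE, hD⟩ := ih hk'.le fun j hj => hstep j (hj.trans (Nat.lt_succ_self k))
    obtain ⟨hRn, hQn⟩ := norm_lead_le_of_lt hX hs h0 h hk1 hk' hE hD
    have hb := norm_blk_le_norm_lead X hk
    have hq := norm_blk_le_norm_lead t.Q hk
    have hr := norm_diagBlk_le_norm_leadSq t.R hk
    have hX' := norm_lead_le_of_le X (Nat.le_succ k) hk
    have hQ' := norm_lead_le_of_le t.Q (Nat.le_succ k) hk
    have hR' := norm_leadSq_le_of_le t.R (Nat.le_succ k) hk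
    have hs1 := hstep ⟨k, hk⟩ (Nat.lt_succ_self k)
    have hE1 := gramErr_succ_le hR hk1 hk hs1
    have hD1 := resErr_succ_le hR hk1 hk hs1
    have hρ := h0.rho_nonneg k
    have hξ := h0.xi_nonneg k
    obtain ⟨n1, n2, n3, n4, n5, n6, n7, n8⟩ := h0
    obtain ⟨k, rfl⟩ := Nat.exists_eq_succ_of_ne_zero (show k ≠ 0 by omega)
    simp only [Nat.succ_eq_add_one] at *
    set x := ‖blk X ⟨k + 1, hk⟩‖
    set K := ‖lead X hk‖
    set K' := ‖lead X hk'.le‖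
    have x0 : 0 ≤ x := norm_nonneg _
    have K0 : 0 ≤ K' := norm_nonneg _
    have hK0 : 0 ≤ K := norm_nonneg _
    constructor
    -- Here 2.6 bounds `1 + 1.4 * 1.12`. Doubled, it stays below the coefficient 12 of `ρ` in `ξ`;
    -- similarly `1.12 ≤ √2` for the coefficient of `δQX`.
    · have hD2 : resErr X t hk'.le ≤ e.rho (k + 1) * (2.6 * K') := by
        refine hD.trans (mul_le_mul_of_nonneg_left ?_ hρ)
        have := mul_le_mul hQn hRn (norm_nonneg _) (by norm_num)
        linarith
      have hs2 : (1.4 : ℝ) ≤ Real.sqrt 2 := Real.le_sqrt_of_sq_le (by norm_num)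
      have hKx : K' * x ≤ K ^ 2 := by rw [sq]; exact mul_le_mul hX' hb x0 hK0
      have hxx : x ^ 2 ≤ K ^ 2 := pow_le_pow_left₀ x0 hb 2
      have hKK : K' ^ 2 ≤ K ^ 2 := pow_le_pow_left₀ K0 hX' 2
      have i1 : resErr X t hk'.le * x ≤ 2.6 * e.rho (k + 1) * K ^ 2 := by
        calc resErr X t hk'.le * x ≤ e.rho (k + 1) * (2.6 * K') * x := by gcongr
          _ = 2.6 * e.rho (k + 1) * (K' * x) := by ring
          _ ≤ _ := by gcongr
      have i2 : ‖leadSq t.R hk'.le‖ * (e.δQX * x) ≤ Real.sqrt 2 * e.δQX * K ^ 2 := by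
        calc ‖leadSq t.R hk'.le‖ * (e.δQX * x) ≤ 1.12 * K' * (e.δQX * x) := by gcongr
          _ = 1.12 * e.δQX * (K' * x) := by ring
          _ ≤ Real.sqrt 2 * e.δQX * K ^ 2 := by gcongr; linarith
      have i3 : (e.δXX + e.δchol + e.δRR) * x ^ 2 ≤ (e.δXX + e.δchol + e.δRR) * K ^ 2 := by
        gcongr
      have i4 : e.xi (k + 1) * K' ^ 2 ≤ e.xi (k + 1) * K ^ 2 := by gcongr
      have i5 : 0 ≤ e.rho (k + 1) * K ^ 2 := by positivity
      rw [ErrConsts.xi]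
      refine hE1.trans ?_
      linarith
    · have j1 : ‖blk t.Q ⟨k + 1, hk⟩‖ * ‖diagBlk t.R ⟨k + 1, hk⟩‖
          ≤ ‖lead t.Q hk‖ * ‖leadSq t.R hk‖ :=
        mul_le_mul hq hr (norm_nonneg _) (norm_nonneg _)
      have j2 : ‖lead t.Q hk'.le‖ * ‖leadSq t.R hk'.le‖ ≤ ‖lead t.Q hk‖ * ‖leadSq t.R hk‖ :=
        mul_le_mul hQ' hR' (norm_nonneg _) (norm_nonneg _)
      have j0 : 0 ≤ ‖lead t.Q hk‖ * ‖leadSq t.R hk‖ := by positivity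
      set q := ‖lead t.Q hk‖ * ‖leadSq t.R hk‖
      -- The reference quantity grows with the number of blocks, so the old residual bound carries
      -- over without any bound for the new basis.
      have j3 : resErr X t hk'.le ≤ e.rho (k + 1) * (K + q) :=
        hD.trans (mul_le_mul_of_nonneg_left (add_le_add hX' j2) hρ)
      have j4 : e.δQR * x ≤ e.δQR * (K + q) := by gcongr; linarith
      have j5 : e.δQ * (‖blk t.Q ⟨k + 1, hk⟩‖ * ‖diagBlk t.R ⟨k + 1, hk⟩‖) ≤ e.δQ * (K + q) := by
        gcongr; linarith
      have j6 : 0 ≤ e.rho (k + 1) * (K + q) := by positivity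
      rw [ErrConsts.rho]
      refine hD1.trans ?_
      linarith

end Induction

/-! ### Scalar rounding errors, sums and inner products. -/

section Scalar

/-- The relative error bound for `n` successive roundings with unit roundoff `u`. -/
def gam (u : ℝ) (n : ℕ) : ℝ := (1 + u) ^ n - 1

theorem gam_nonneg {u : ℝ} (hu : 0 ≤ u) (n : ℕ) : 0 ≤ gam u n := by
  have := one_le_pow₀ (n := n) (show (1 : ℝ) ≤ 1 + u by linarith)
  unfold gam; linarith

theorem gam_succ (u : ℝ) (n : ℕ) : gam u (n + 1) = gam u n * (1 + u) + u := by
  unfold gam; ring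

theorem gam_mono {u v : ℝ} (hu : 0 ≤ u) (huv : u ≤ v) {n k : ℕ} (hnk : n ≤ k) :
    gam u n ≤ gam v k := by
  unfold gam
  have h1 : (1 + u) ^ n ≤ (1 + u) ^ k := pow_le_pow_right₀ (by linarith) hnk
  have h2 : (1 + u) ^ k ≤ (1 + v) ^ k := pow_le_pow_left₀ (by linarith) (by linarith) k
  linarith

theorem le_gam {u : ℝ} (hu : 0 ≤ u) {n : ℕ} (hn : 1 ≤ n) : u ≤ gam u n := by
  have := gam_mono hu le_rfl hn
  unfold gam at this ⊢
  linarith [pow_one (1 + u)]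

theorem gam_le_two_mul {u : ℝ} (hu : 0 ≤ u) {n : ℕ} (h : n * u ≤ 1) : gam u n ≤ 2 * (n * u) := by
  have h0 : 0 ≤ n * u := by positivity
  have h1 : (1 + u) ^ n ≤ Real.exp (n * u) := by
    rw [Real.exp_nat_mul]
    exact pow_le_pow_left₀ (by linarith) (by linarith [Real.add_one_le_exp u]) n
  have h2 := Real.abs_exp_sub_one_le (x := n * u) (by rwa [abs_of_nonneg h0])
  rw [abs_of_nonneg h0] at h2
  have h3 := le_abs_self (Real.exp (n * u) - 1)
  unfold gam; linarith

theorem Rounds.abs_sub_le {u x y : ℝ} (h : Rounds u x y) : |y - x| ≤ u * |x| := by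
  obtain ⟨δ, hδ, rfl⟩ := h
  rw [show x * (1 + δ) - x = δ * x by ring, abs_mul]
  gcongr

theorem Rounds.abs_le {u x y : ℝ} (h : Rounds u x y) : |y| ≤ (1 + u) * |x| := by
  have h1 := h.abs_sub_le
  have h2 := abs_sub_abs_le_abs_sub y x
  linarith

theorem Rounds.abs_le_two_mul {u x y : ℝ} (hu : u ≤ 1 / 2) (h : Rounds u x y) :
    |x| ≤ 2 * |y| := by
  have h1 := h.abs_sub_le
  have h2 := abs_sub_abs_le_abs_sub x y
  rw [abs_sub_comm] at h2
  nlinarith [abs_nonneg x]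

/-- The effect of rounding both factors of a product. -/
theorem Rounds.abs_mul_sub_le {u x y x' y' : ℝ} (hu : u ≤ 1 / 2) (hx : Rounds u x x')
    (hy : Rounds u y y') : |x' * y' - x * y| ≤ 5 / 2 * u * |x * y| := by
  have h0 := hy.abs_le
  have h1 := hx.abs_sub_le
  have h2 := hy.abs_sub_le
  have h3 : |x' * y' - x * y| ≤ |x' - x| * |y'| + |x| * |y' - y| := by
    rw [show x' * y' - x * y = (x' - x) * y' + x * (y' - y) by ring, ← abs_mul, ← abs_mul]
    exact abs_add_le _ _
  have hu0 : 0 ≤ u := by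
    obtain ⟨δ, hδ, -⟩ := hx
    exact (abs_nonneg _).trans hδ
  have h4 : |x' - x| * |y'| ≤ (u * |x|) * ((1 + u) * |y|) :=
    mul_le_mul h1 h0 (abs_nonneg _) (by positivity)
  have h5 : |x| * |y' - y| ≤ |x| * (u * |y|) := by gcongr
  rw [abs_mul]
  have h6 : u * (u * (|x| * |y|)) ≤ 1 / 2 * (u * (|x| * |y|)) := by gcongr
  linarith

theorem FlSum.card_pos {u : ℝ} {S : Multiset ℝ} {c : ℝ} (h : FlSum u S c) : 0 < S.card := by
  induction h with
  | single x => simp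
  | add _ _ _ h1 h2 => simp; omega

/-- The error of a sum, evaluated in any order. -/
theorem FlSum.abs_sub_le {u : ℝ} (hu : 0 ≤ u) {S : Multiset ℝ} {c : ℝ} (h : FlSum u S c) :
    ∀ n, S.card ≤ n + 1 → |c - S.sum| ≤ gam u n * (S.map abs).sum := by
  induction h with
  | single x =>
    intro n _
    simpa using mul_nonneg (gam_nonneg hu n) (abs_nonneg x)
  | @add S T a b c hS hT hr h1 h2 =>
    intro n hn
    have h3 := hS.card_pos
    have h4 := hT.card_pos
    rw [Multiset.card_add] at hn
    -- Both parts of the sum are nonempty, hence smaller than the whole, and can be charged one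
    -- rounding less. The final addition restores it through `gam_succ`.
    obtain ⟨n, rfl⟩ := Nat.exists_eq_succ_of_ne_zero (show n ≠ 0 by omega)
    have i1 := h1 n (by omega)
    have i2 := h2 n (by omega)
    have i3 := hr.abs_sub_le
    have abs_sum_le : ∀ S : Multiset ℝ, |S.sum| ≤ (S.map abs).sum := fun S => by
      induction S using Multiset.induction with
      | empty => simp
      | cons a S ih => simpa using (abs_add_le _ _).trans (by linarith)
    have i4 := abs_sum_le S
    have i5 := abs_sum_le T
    have i6 : |a + b| ≤ |a - S.sum| + |b - T.sum| + (|S.sum| + |T.sum|) := by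
      rw [show a + b = (a - S.sum) + (b - T.sum) + (S.sum + T.sum) by ring]
      exact (abs_add_le _ _).trans (add_le_add (abs_add_le _ _) (abs_add_le _ _))
    have i7 : |c - (S + T).sum| ≤ |a - S.sum| + |b - T.sum| + |c - (a + b)| := by
      rw [Multiset.sum_add, show c - (S.sum + T.sum)
        = (a - S.sum) + (b - T.sum) + (c - (a + b)) by ring]
      exact (abs_add_le _ _).trans (add_le_add (abs_add_le _ _) le_rfl)
    have i8 : u * |a + b| ≤ u * (gam u n * (S.map abs).sum + gam u n * (T.map abs).sum
        + ((S.map abs).sum + (T.map abs).sum)) := by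
      gcongr; linarith
    rw [Multiset.map_add, Multiset.sum_add (S.map abs), Nat.succ_eq_add_one, gam_succ]
    linarith

/-- The error of an inner product, given that of the sum of the rounded products. -/
theorem abs_sub_dot_le {ι : Type*} (T : Finset ι) {u g a d : ℝ} {σ : ℝ} (hσ : |σ| = 1)
    (hg : 0 ≤ g) {x z : ι → ℝ}
    (hz : ∀ l ∈ T, Rounds u (x l) (z l))
    (h : |d - (a + ∑ l ∈ T, σ * z l)| ≤ g * (|a| + ∑ l ∈ T, |z l|)) :
    |d - (a + ∑ l ∈ T, σ * x l)| ≤ g * |a| + (g * (1 + u) + u) * ∑ l ∈ T, |x l| := by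
  have h1 : ∑ l ∈ T, |z l| ≤ (1 + u) * ∑ l ∈ T, |x l| := by
    rw [Finset.mul_sum]
    exact Finset.sum_le_sum fun l hl => (hz l hl).abs_le
  have h2 : |∑ l ∈ T, σ * z l - ∑ l ∈ T, σ * x l| ≤ u * ∑ l ∈ T, |x l| := by
    rw [← Finset.sum_sub_distrib, Finset.mul_sum]
    refine (Finset.abs_sum_le_sum_abs _ _).trans (Finset.sum_le_sum fun l hl => ?_)
    rw [← mul_sub, abs_mul, hσ, one_mul]
    exact (hz l hl).abs_sub_le
  have h3 : |d - (a + ∑ l ∈ T, σ * x l)| ≤ |d - (a + ∑ l ∈ T, σ * z l)|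
      + |∑ l ∈ T, σ * z l - ∑ l ∈ T, σ * x l| := by
    rw [show d - (a + ∑ l ∈ T, σ * x l) = (d - (a + ∑ l ∈ T, σ * z l))
      + (∑ l ∈ T, σ * z l - ∑ l ∈ T, σ * x l) by ring]
    exact abs_add_le _ _
  have h4 := mul_le_mul_of_nonneg_left h1 hg
  linarith

/-- At most `s` additions for `s + 1` summands, plus one rounding in each product. -/
theorem FlSubDot.abs_sub_le {s : ℕ} {u a d : ℝ} (hu : 0 ≤ u) {i : Fin s} {f g : Fin s → ℝ}
    (h : FlSubDot u a i f g d) {N : ℕ} (hN : s + 1 ≤ N) :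
    |d - (a - ∑ l with l < i, f l * g l)| ≤ gam u N * (|a| + ∑ l with l < i, |f l * g l|) := by
  obtain ⟨z, hz, hd⟩ := h
  have hcard : (Finset.univ.filter (fun l : Fin s => l < i)).card ≤ s := by
    simpa using Finset.card_filter_le (Finset.univ : Finset (Fin s)) (fun l => l < i)
  have h1 := hd.abs_sub_le hu s (by
    rw [Multiset.card_cons, Multiset.card_map]
    exact Nat.succ_le_succ hcard)
  have h2 : |d - (a + ∑ l with l < i, (-1) * z l)|
      ≤ gam u s * (|a| + ∑ l with l < i, |z l|) := by
    convert h1 using 2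
    · simp [Finset.sum]
    · simp [Finset.sum, Multiset.map_map]
  have h3 := abs_sub_dot_le _ (by simp) (gam_nonneg hu s) (fun l hl => hz l (by simpa using hl)) h2
  rw [← Finset.mul_sum, neg_one_mul, ← sub_eq_add_neg] at h3
  have h4 := gam_succ u s
  have h5 := gam_mono hu le_rfl hN
  have h6 := gam_mono hu le_rfl (Nat.le_succ s)
  have h7 : 0 ≤ ∑ l with l < i, |f l * g l| := Finset.sum_nonneg fun _ _ => abs_nonneg _
  refine h3.trans ?_
  rw [← h4, mul_add]
  gcongr
  exact h6.trans h5

theorem sum_eq_sum_filter_lt_add {s : ℕ} (i : Fin s) (F : Fin s → ℝ) (h : ∀ l, i < l → F l = 0) :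
    ∑ l, F l = ∑ l with l < i, F l + F i := by
  rw [← Finset.sum_filter_add_sum_filter_not Finset.univ (· < i)]
  congr 1
  refine Finset.sum_eq_single i (fun l hl hne => h l ?_) (by simp)
  simp only [Finset.mem_filter, Finset.mem_univ, true_and, not_lt] at hl
  exact lt_of_le_of_ne hl (Ne.symm hne)

end Scalar

/-! ### Rounding errors of matrix products and differences. -/

section MatrixOps

variable {l n r : Type*} [Fintype l] [Fintype n] [Fintype r] [DecidableEq l] [DecidableEq n]
  [DecidableEq r]

theorem FlMul.abs_sub_le {u : ℝ} (hu : 0 ≤ u) {A : Matrix l n ℝ} {B : Matrix n r ℝ}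
    {C : Matrix l r ℝ} (h : FlMul u A B C) {N : ℕ} (hN : Fintype.card n + 1 ≤ N) (i : l) (j : r) :
    |(C - A * B) i j| ≤ gam u N * ∑ t, |A i t * B t j| := by
  obtain ⟨z, hz, hd⟩ := h i j
  have h1 := hd.abs_sub_le hu (Fintype.card n) (by simp)
  have h2 : |C i j - (0 + ∑ l, 1 * z l)|
      ≤ gam u (Fintype.card n) * (|0| + ∑ l, |z l|) := by
    convert h1 using 2
    · simp
    · simp
  have h3 := abs_sub_dot_le _ (by simp) (gam_nonneg hu _) (fun l _ => hz l) h2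
  rw [← Finset.mul_sum, ← gam_succ, zero_add, one_mul, abs_zero, mul_zero, zero_add] at h3
  rw [Matrix.sub_apply, Matrix.mul_apply]
  refine h3.trans ?_
  have := gam_mono hu le_rfl hN
  gcongr

theorem sum_abs_mul_le (A : Matrix l n ℝ) (B : Matrix n r ℝ) (i : l) (j : r) :
    ∑ t, |A i t * B t j| ≤ Fintype.card n * (‖A‖ * ‖B‖) := by
  calc ∑ t, |A i t * B t j| ≤ ∑ _t : n, ‖A‖ * ‖B‖ := by
        refine Finset.sum_le_sum fun t _ => ?_
        rw [abs_mul]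
        exact mul_le_mul (abs_apply_le_norm A i t) (abs_apply_le_norm B t j) (abs_nonneg _)
          (norm_nonneg _)
    _ = _ := by simp

theorem FlMul.norm_sub_le {u : ℝ} (hu : 0 ≤ u) {A : Matrix l n ℝ} {B : Matrix n r ℝ}
    {C : Matrix l r ℝ} (h : FlMul u A B C) {D : ℕ} (hl : Fintype.card l ≤ D)
    (hn : Fintype.card n ≤ D) (hr : Fintype.card r ≤ D) :
    ‖C - A * B‖ ≤ D ^ 3 * gam u (D + 1) * (‖A‖ * ‖B‖) := by
  have hg := gam_nonneg hu (D + 1)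
  have h1 : ∀ i j, |(C - A * B) i j| ≤ gam u (D + 1) * (Fintype.card n * (‖A‖ * ‖B‖)) :=
    fun i j => (h.abs_sub_le hu (Nat.succ_le_succ hn) i j).trans
      (mul_le_mul_of_nonneg_left (sum_abs_mul_le A B i j) hg)
  calc ‖C - A * B‖ ≤ Fintype.card l * Fintype.card r *
        (gam u (D + 1) * (Fintype.card n * (‖A‖ * ‖B‖))) :=
        norm_le_of_forall_abs_le (by positivity) h1
    _ ≤ D * D * (gam u (D + 1) * (D * (‖A‖ * ‖B‖))) := by gcongr
    _ = _ := by ring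

theorem FlSub.norm_sub_le {u : ℝ} (hu : 0 ≤ u) {A B C : Matrix l r ℝ} (h : FlSub u A B C)
    {D : ℕ} (hD : 1 ≤ D) (hl : Fintype.card l ≤ D) (hr : Fintype.card r ≤ D) :
    ‖C - (A - B)‖ ≤ D ^ 3 * gam u (D + 1) * ‖A - B‖ := by
  have h1 : ∀ i j, |(C - (A - B)) i j| ≤ u * ‖A - B‖ := fun i j =>
    (h i j).abs_sub_le.trans (mul_le_mul_of_nonneg_left (abs_apply_le_norm (A - B) i j) hu)
  have hg := le_gam hu (Nat.succ_le_succ (Nat.zero_le D))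
  calc ‖C - (A - B)‖ ≤ Fintype.card l * Fintype.card r * (u * ‖A - B‖) :=
        norm_le_of_forall_abs_le (by positivity) h1
    _ ≤ D * D * (gam u (D + 1) * ‖A - B‖) := by gcongr
    _ = D ^ 2 * (gam u (D + 1) * ‖A - B‖) := by ring
    _ ≤ D ^ 3 * (gam u (D + 1) * ‖A - B‖) := by
      have := gam_nonneg hu (D + 1)
      gcongr
      · exact_mod_cast hD
      · norm_num
    _ = _ := by ring

end MatrixOps

/-! ### Backward error of a completed Cholesky factorization. -/

section Cholesky

variable {s : ℕ} {A R : Matrix (Fin s) (Fin s) ℝ} {u h : ℝ}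

theorem FlChol.diag_ne_zero (hR : FlChol u A R) (hu : u ≤ 1 / 2) (i : Fin s) : R i i ≠ 0 := by
  obtain ⟨d, -, hd, hr⟩ := hR.2.1 i
  have h1 := hr.abs_le_two_mul hu
  have h2 := Real.sqrt_pos.2 hd
  intro h0
  rw [h0, abs_zero, mul_zero, abs_of_pos h2] at h1
  linarith

/-- The diagonal of the computed Cholesky factorization. -/
theorem FlChol.diag_bounds (hR : FlChol u A R) (hu : 0 ≤ u) {N : ℕ} (hN : s + 1 ≤ N)
    (hγ : gam u N ≤ 1 / 2) (hA : ∀ i j, |A i j| ≤ h) (i : Fin s) :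
    ∑ l with l < i, R l i * R l i ≤ 3 * h ∧ R i i * R i i ≤ 6 * h ∧
      |∑ l with l < i, R l i * R l i + R i i * R i i - A i i| ≤ 8 * gam u N * h := by
  obtain ⟨d, hdot, hd, hr⟩ := hR.2.1 i
  have huγ := le_gam hu (show 1 ≤ N by omega)
  have hγ0 := gam_nonneg hu N
  have h1 := hdot.abs_sub_le hu hN
  simp only [abs_mul_self] at h1
  have hS : 0 ≤ ∑ l with l < i, R l i * R l i := Finset.sum_nonneg fun _ _ => mul_self_nonneg _
  set S := ∑ l with l < i, R l i * R l i
  have h2 := hA i i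
  have h0 : 0 ≤ h := (abs_nonneg _).trans h2
  have h3 : gam u N * (|A i i| + S) ≤ 1 / 2 * (h + S) := by gcongr
  -- Positivity of the pivot replaces definiteness of `A`: from `0 < d ≤ A i i - S + (h + S) / 2`
  -- follow `S ≤ 3h` and `d ≤ 3h/2`.
  have h4 := (abs_le.1 h1).2
  have h5 := le_abs_self (A i i)
  have hdh : d ≤ 3 / 2 * h := by linarith
  have hSh : S ≤ 3 * h := by linarith
  have h6 := hr.abs_mul_sub_le (by linarith) hr
  rw [Real.mul_self_sqrt hd.le, abs_of_pos hd] at h6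
  have h7 : 5 / 2 * u * d ≤ 5 / 2 * gam u N * (3 / 2 * h) := by gcongr
  have h8 : gam u N * (|A i i| + S) ≤ gam u N * (h + 3 * h) := by gcongr
  have h9 : gam u N * h ≤ 1 / 2 * h := by gcongr
  refine ⟨hSh, ?_, ?_⟩
  · linarith [(abs_le.1 h6).2]
  · have h10 : |S + R i i * R i i - A i i| ≤ |d - (A i i - S)| + |R i i * R i i - d| := by
      rw [show S + R i i * R i i - A i i = (d - (A i i - S)) + (R i i * R i i - d) by ring]
      exact abs_add_le _ _
    have : 0 ≤ gam u N * h := by positivity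
    linarith

theorem FlChol.sq_le (hR : FlChol u A R) (hu : 0 ≤ u) {N : ℕ} (hN : s + 1 ≤ N)
    (hγ : gam u N ≤ 1 / 2) (hA : ∀ i j, |A i j| ≤ h) (l i : Fin s) : R l i * R l i ≤ 6 * h := by
  obtain ⟨h1, h2, -⟩ := hR.diag_bounds hu hN hγ hA i
  have h0 : 0 ≤ h := (abs_nonneg _).trans (hA i i)
  rcases lt_trichotomy l i with hl | rfl | hl
  · have : R l i * R l i ≤ ∑ l with l < i, R l i * R l i :=
      Finset.single_le_sum (f := fun l => R l i * R l i) (fun _ _ => mul_self_nonneg _)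
        (by simpa using hl)
    linarith
  · exact h2
  · rw [hR.1 l i hl]; linarith

theorem FlChol.abs_mul_le (hR : FlChol u A R) (hu : 0 ≤ u) {N : ℕ} (hN : s + 1 ≤ N)
    (hγ : gam u N ≤ 1 / 2) (hA : ∀ i j, |A i j| ≤ h) (l i l' j : Fin s) :
    |R l i * R l' j| ≤ 6 * h := by
  have h1 := hR.sq_le hu hN hγ hA l i
  have h2 := hR.sq_le hu hN hγ hA l' j
  rw [abs_le]
  constructor <;> nlinarith [sq_nonneg (R l i + R l' j), sq_nonneg (R l i - R l' j)]

theorem FlChol.abs_sub_le_of_le (hR : FlChol u A R) (hu : 0 ≤ u) {N : ℕ} (hN : s + 1 ≤ N)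
    (hγ : gam u N ≤ 1 / 2) (hA : ∀ i j, |A i j| ≤ h) {i j : Fin s} (hij : i ≤ j) :
    |(Rᵀ * R) i j - A i j| ≤ 19 * s * gam u N * h := by
  have hs : (1 : ℝ) ≤ s := by exact_mod_cast i.pos
  have h0 : 0 ≤ h := (abs_nonneg _).trans (hA i i)
  have hγ0 := gam_nonneg hu N
  have huγ := le_gam hu (show 1 ≤ N by omega)
  have hγh : 0 ≤ gam u N * h := by positivity
  have hsγh : gam u N * h ≤ s * (gam u N * h) := le_mul_of_one_le_left hγh hs
  have hsum : (Rᵀ * R) i j = ∑ l with l < i, R l i * R l j + R i i * R i j := by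
    rw [Matrix.mul_apply]
    exact sum_eq_sum_filter_lt_add i (fun l => R l i * R l j) fun l hl => by
      rw [hR.1 l i hl, zero_mul]
  rw [hsum]
  rcases hij.eq_or_lt with rfl | hlt
  · obtain ⟨-, -, h1⟩ := hR.diag_bounds hu hN hγ hA i
    linarith
  · obtain ⟨t, hdot, hr⟩ := hR.2.2 i j hlt
    have h1 := hdot.abs_sub_le hu hN
    set S := ∑ l with l < i, R l i * R l j
    have h2 : ∑ l with l < i, |R l i * R l j| ≤ s * (6 * h) := by
      calc ∑ l with l < i, |R l i * R l j| ≤ ∑ l, |R l i * R l j| :=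
            Finset.sum_le_sum_of_subset_of_nonneg (Finset.filter_subset _ _)
              fun _ _ _ => abs_nonneg _
        _ ≤ ∑ _l : Fin s, 6 * h := Finset.sum_le_sum fun l _ => hR.abs_mul_le hu hN hγ hA l i l j
        _ = _ := by simp
    have hii := hR.diag_ne_zero (by linarith) i
    -- Multiplying by the nonzero pivot turns the rounded quotient into a relative perturbation of
    -- `t`.
    have hr' : Rounds u t (R i i * R i j) := by
      obtain ⟨δ, hδ, he⟩ := hr
      exact ⟨δ, hδ, by rw [he]; field_simp⟩
    have h3 := hr'.abs_le_two_mul (by linarith)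
    have h4 := hr'.abs_sub_le
    have h5 := hR.abs_mul_le hu hN hγ hA i i i j
    have h6 : u * |t| ≤ gam u N * (12 * h) := by gcongr; linarith
    have h7 : gam u N * (|A i j| + ∑ l with l < i, |R l i * R l j|)
        ≤ gam u N * (h + s * (6 * h)) := by gcongr; exact hA i j
    have h8 : |S + R i i * R i j - A i j| ≤ |t - (A i j - S)| + |R i i * R i j - t| := by
      rw [show S + R i i * R i j - A i j = (t - (A i j - S)) + (R i i * R i j - t) by ring]
      exact abs_add_le _ _
    linarith

/-- The error of the Cholesky factorization of a nearly symmetric matrix. -/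
theorem FlChol.abs_sub_le (hR : FlChol u A R) (hu : 0 ≤ u) {N : ℕ} (hN : s + 1 ≤ N)
    (hγ : gam u N ≤ 1 / 2) (hA : ∀ i j, |A i j| ≤ h) {η : ℝ} (hη : ∀ i j, |A i j - A j i| ≤ η)
    (i j : Fin s) : |(Rᵀ * R) i j - A i j| ≤ 19 * s * gam u N * h + η := by
  have h1 : 0 ≤ η := (abs_nonneg _).trans (hη i i)
  rcases le_total i j with hij | hij
  · have := hR.abs_sub_le_of_le hu hN hγ hA hij
    linarith
  · have h2 := hR.abs_sub_le_of_le hu hN hγ hA hij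
    have h3 : (Rᵀ * R) i j = (Rᵀ * R) j i := by
      simp only [Matrix.mul_apply, Matrix.transpose_apply, mul_comm]
    rw [h3, show (Rᵀ * R) j i - A i j = ((Rᵀ * R) j i - A j i) + (A j i - A i j) by ring]
    exact (abs_add_le _ _).trans (add_le_add h2 (hη j i))

/-- The error of the Cholesky factorization, after rounding the factor to a lower precision. -/
theorem FlChol.abs_sub_le_of_cast {v : ℝ} {T : Matrix (Fin s) (Fin s) ℝ} (hR : FlChol u A R)
    (hT : FlCast v R T) (hu : 0 ≤ u) (huv : u ≤ v) {N : ℕ} (hN : s + 1 ≤ N)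
    (hγ : gam v N ≤ 1 / 2) (hA : ∀ i j, |A i j| ≤ h) {η : ℝ} (hη : ∀ i j, |A i j - A j i| ≤ η)
    (i j : Fin s) : |(Tᵀ * T - A) i j| ≤ 34 * s * gam v N * h + η := by
  have hγuv : gam u N ≤ gam v N := gam_mono hu huv le_rfl
  have h1 := hR.abs_sub_le hu hN (hγuv.trans hγ) hA hη i j
  have hv := le_gam (hu.trans huv) (show 1 ≤ N by omega)
  have h0 : 0 ≤ h := (abs_nonneg _).trans (hA i i)
  -- Rounding both factors perturbs each product by `5/2 * v` relatively, and products are at most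
  -- `6h`; together with 19 this gives 34.
  have h2 : |(Tᵀ * T) i j - (Rᵀ * R) i j| ≤ s * (15 * gam v N * h) := by
    rw [Matrix.mul_apply, Matrix.mul_apply, ← Finset.sum_sub_distrib]
    refine (Finset.abs_sum_le_sum_abs _ _).trans ?_
    calc ∑ l, |Tᵀ i l * T l j - Rᵀ i l * R l j| ≤ ∑ _l : Fin s, 15 * gam v N * h := by
          refine Finset.sum_le_sum fun l _ => ?_
          have h3 := (hT l i).abs_mul_sub_le (by linarith) (hT l j)
          have h4 := hR.abs_mul_le hu hN (hγuv.trans hγ) hA l i l j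
          have hv0 := hu.trans huv
          have hγ0 := gam_nonneg hv0 N
          refine h3.trans ?_
          calc 5 / 2 * v * |R l i * R l j| ≤ 5 / 2 * gam v N * (6 * h) := by gcongr
            _ = _ := by ring
      _ = _ := by simp
  rw [Matrix.sub_apply, show (Tᵀ * T) i j - A i j
    = ((Tᵀ * T) i j - (Rᵀ * R) i j) + ((Rᵀ * R) i j - A i j) by ring]
  have h5 : 19 * s * gam u N * h ≤ 19 * s * gam v N * h := by gcongr
  refine (abs_add_le _ _).trans ?_
  linarith

end Cholesky

/-! ### Residual of triangular substitution. -/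

section TriSolve

variable {m s : ℕ} {u v : ℝ} {V Y Q : Matrix (Fin m) (Fin s) ℝ} {R T : Matrix (Fin s) (Fin s) ℝ}

theorem FlTriSolve.abs_sub_le (hY : FlTriSolve u V R Y) (hu : 0 ≤ u) {N : ℕ} (hN : s + 1 ≤ N)
    (hγ : gam u N ≤ 1 / 2) (htri : ∀ i j, j < i → R i j = 0) (hdiag : ∀ i, R i i ≠ 0)
    (i : Fin m) (j : Fin s) : |(Y * R) i j - V i j| ≤ 6 * gam u N * ∑ l, |Y i l * R l j| := by
  obtain ⟨t, hdot, hr⟩ := hY i j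
  have hγ0 := gam_nonneg hu N
  have huγ := le_gam hu (show 1 ≤ N by omega)
  have hsum : (Y * R) i j = ∑ l with l < j, Y i l * R l j + Y i j * R j j := by
    rw [Matrix.mul_apply]
    exact sum_eq_sum_filter_lt_add j (fun l => Y i l * R l j) fun l hl => by
      rw [htri l j hl, mul_zero]
  have hsum' : ∑ l, |Y i l * R l j| = ∑ l with l < j, |Y i l * R l j| + |Y i j * R j j| :=
    sum_eq_sum_filter_lt_add j (fun l => |Y i l * R l j|) fun l hl => by
      rw [htri l j hl, mul_zero, abs_zero]
  have h1 := hdot.abs_sub_le hu hN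
  have habs : |∑ l with l < j, Y i l * R l j| ≤ ∑ l with l < j, |Y i l * R l j| :=
    Finset.abs_sum_le_sum_abs _ _
  rw [hsum, hsum']
  set S := ∑ l with l < j, Y i l * R l j
  set S' := ∑ l with l < j, |Y i l * R l j|
  have hr' : Rounds u t (Y i j * R j j) := by
    obtain ⟨δ, hδ, he⟩ := hr
    have := hdiag j
    exact ⟨δ, hδ, by rw [he]; field_simp⟩
  have h2 := hr'.abs_le_two_mul (by linarith)
  have h3 := hr'.abs_sub_le
  have hS' : 0 ≤ S' := (abs_nonneg _).trans habs
  have h4 : gam u N * (|V i j| + S') ≤ 1 / 2 * (|V i j| + S') := by gcongr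
  have h5 : |V i j| ≤ |t - (V i j - S)| + |t| + |S| := by
    rw [show V i j = (-(t - (V i j - S))) + t + S by ring]
    refine (abs_add_le _ _).trans (add_le_add ((abs_add_le _ _).trans ?_) le_rfl)
    rw [abs_neg]
    exact le_of_eq (by ring_nf)
  -- The right-hand side is eliminated in favour of the computed products, since the residual must
  -- be bounded by those alone.
  have h6 : |V i j| ≤ 2 * |t| + 3 * S' := by linarith
  have h7 : gam u N * (|V i j| + S') ≤ gam u N * (4 * |Y i j * R j j| + 4 * S') :=
    mul_le_mul_of_nonneg_left (by linarith) hγ0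
  have h8 : u * |t| ≤ gam u N * (2 * |Y i j * R j j|) := by gcongr
  have h9 : |S + Y i j * R j j - V i j| ≤ |t - (V i j - S)| + |Y i j * R j j - t| := by
    rw [show S + Y i j * R j j - V i j = (t - (V i j - S)) + (Y i j * R j j - t) by ring]
    exact abs_add_le _ _
  have h10 : 0 ≤ gam u N * S' := by positivity
  linarith

/-- The error of a triangular solve, after rounding the solution and the triangular matrix to a
lower precision. -/
theorem FlTriSolve.abs_sub_le_of_cast (hY : FlTriSolve u V R Y) (hQ : FlCast v Y Q)
    (hT : FlCast v R T) (hu : 0 ≤ u) (huv : u ≤ v) {N : ℕ} (hN : s + 1 ≤ N)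
    (hγ : gam v N ≤ 1 / 2) (htri : ∀ i j, j < i → R i j = 0) (hdiag : ∀ i, R i i ≠ 0)
    (i : Fin m) (j : Fin s) : |(Q * T - V) i j| ≤ 34 * gam v N * ∑ l, |Q i l * T l j| := by
  have hγuv : gam u N ≤ gam v N := gam_mono hu huv le_rfl
  have hv := le_gam (hu.trans huv) (show 1 ≤ N by omega)
  have h1 := hY.abs_sub_le hu hN (hγuv.trans hγ) htri hdiag i j
  -- The target bound involves the rounded factors. Rounding at most halves each entry, so the
  -- products cost a factor 4, and `34 = (5/2 + 6) * 4`.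
  have h2 : ∑ l, |Y i l * R l j| ≤ 4 * ∑ l, |Q i l * T l j| := by
    rw [Finset.mul_sum]
    refine Finset.sum_le_sum fun l _ => ?_
    rw [abs_mul, abs_mul]
    have h3 := (hQ i l).abs_le_two_mul (by linarith)
    have h4 := (hT l j).abs_le_two_mul (by linarith)
    calc |Y i l| * |R l j| ≤ (2 * |Q i l|) * (2 * |T l j|) := by gcongr
      _ = _ := by ring
  have h5 : |(Q * T) i j - (Y * R) i j| ≤ 5 / 2 * v * ∑ l, |Y i l * R l j| := by
    rw [Matrix.mul_apply, Matrix.mul_apply, ← Finset.sum_sub_distrib, Finset.mul_sum]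
    exact (Finset.abs_sum_le_sum_abs _ _).trans
      (Finset.sum_le_sum fun l _ => (hQ i l).abs_mul_sub_le (by linarith) (hT l j))
  have hv0 := hu.trans huv
  have hγ0 := gam_nonneg hv0 N
  have h6 : 5 / 2 * v * ∑ l, |Y i l * R l j| ≤ 5 / 2 * gam v N * (4 * ∑ l, |Q i l * T l j|) := by
    gcongr
  have h7 : 6 * gam u N * ∑ l, |Y i l * R l j| ≤ 6 * gam v N * (4 * ∑ l, |Q i l * T l j|) := by
    gcongr
  rw [Matrix.sub_apply, show (Q * T) i j - V i j
    = ((Q * T) i j - (Y * R) i j) + ((Y * R) i j - V i j) by ring]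
  refine (abs_add_le _ _).trans ?_
  linarith

end TriSolve

/-! ### Rounding analysis of a whole run and the two main conclusions. -/

section Run

variable {m p s : ℕ} {εh εl : ℝ} {X : Matrix (Fin m) (Fin p × Fin s) ℝ}
  {intra : Matrix (Fin m) (Fin s) ℝ → Matrix (Fin m) (Fin s) ℝ × Matrix (Fin s) (Fin s) ℝ}
  {t : Trace m p s}

/-- The rounding errors in the processing of a block after the first one. -/
theorem IsPIPMP.stepBounds_of_pos (ht : IsPIPMP εh εl X intra t) (hεh : 0 ≤ εh) (hε : εh ≤ εl)
    {D : ℕ} (hD : 1 ≤ D) (hmD : m ≤ D) (hpD : p * s ≤ D)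
    (hη : (D : ℝ) ^ 3 * gam εl (D + 1) ≤ 1 / 2) {k : Fin p} (hk : 0 < (k : ℕ))
    (hQ : ‖lead t.Q k.isLt.le‖ ≤ 2) {e : ErrConsts}
    (hQX : 2 * (D ^ 3 * gam εl (D + 1)) ≤ e.δQX) (hXX : D ^ 3 * gam εh (D + 1) ≤ e.δXX)
    (hRR : 50 * (D ^ 3 * gam εh (D + 1)) ≤ e.δRR)
    (hchol : 2414 * D ^ 2 * (D ^ 3 * gam εl (D + 1)) ≤ e.δchol)
    (hQR : 25 * (D ^ 3 * gam εl (D + 1)) ≤ e.δQR) (hQ' : 34 * (D ^ 3 * gam εl (D + 1)) ≤ e.δQ) :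
    StepBounds e X t k := by
  have hεl := hεh.trans hε
  have hD' : (1 : ℝ) ≤ D := by exact_mod_cast hD
  have hγl := gam_nonneg hεl (D + 1)
  have hγh := gam_nonneg hεh (D + 1)
  have hγhl : gam εh (D + 1) ≤ gam εl (D + 1) := gam_mono hεh hε le_rfl
  have hD3 : (1 : ℝ) ≤ (D : ℝ) ^ 3 := one_le_pow₀ hD'
  have hγ : gam εl (D + 1) ≤ 1 / 2 := (le_mul_of_one_le_left hγl hD3).trans hη
  have hsp : s ≤ D := (Nat.le_mul_of_pos_left s (Fin.pos k)).trans hpD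
  have hks : Fintype.card (Fin (k : ℕ) × Fin s) ≤ D := by
    simpa using (Nat.mul_le_mul_right s k.isLt.le).trans hpD
  have hm : Fintype.card (Fin m) ≤ D := by simpa using hmD
  have hs : Fintype.card (Fin s) ≤ D := by simpa using hsp
  have hs' : (s : ℝ) ≤ D := by exact_mod_cast hsp
  have hm' : (m : ℝ) ≤ D := by exact_mod_cast hmD
  have e1 := (ht.inner k hk).norm_sub_le hεl hks hm hs
  have e2 := (ht.gram k hk).norm_sub_le hεh hs hm hs
  have e3 := (ht.pyth k hk).norm_sub_le hεh hs hks hs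
  have e4 := (ht.sub k hk).norm_sub_le hεh hD hs hs
  have e5 := (ht.prod k hk).norm_sub_le hεl hm hks hs
  have e6 := (ht.proj k hk).norm_sub_le hεl hD hm hs
  have hch := ht.chol k hk
  have hsol := ht.solve k hk
  have hcQ := ht.castQ k hk
  have hcR := ht.castR k hk
  set ηl := (D : ℝ) ^ 3 * gam εl (D + 1) with hηl
  set ηh := (D : ℝ) ^ 3 * gam εh (D + 1) with hηh
  have hηl0 : 0 ≤ ηl := by positivity
  have hηh0 : 0 ≤ ηh := by positivity
  have hηhl : ηh ≤ ηl := by rw [hηl, hηh]; gcongr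
  set S := above t.R k
  set x := blk X k
  set Q := lead t.Q k.isLt.le
  set T := diagBlk t.R k
  set q := blk t.Q k
  rw [norm_transpose] at e1 e2 e3
  have x0 : 0 ≤ ‖x‖ := norm_nonneg x
  have f1 : ‖S - Qᵀ * x‖ ≤ 2 * ηl * ‖x‖ := by
    refine e1.trans ?_
    calc ηl * (‖Q‖ * ‖x‖) ≤ ηl * (2 * ‖x‖) := by gcongr
      _ = _ := by ring
  have hS : ‖S‖ ≤ 4 * ‖x‖ := by
    have h1 : ‖Qᵀ * x‖ ≤ 2 * ‖x‖ := (norm_mul_le' _ _).trans (by rw [norm_transpose]; gcongr)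
    have h2 := norm_le_norm_add_norm_sub' S (Qᵀ * x)
    have h3 : 2 * ηl * ‖x‖ ≤ 2 * (1 / 2) * ‖x‖ := by gcongr
    linarith
  have f2 : ‖t.P k - xᵀ * x‖ ≤ ηh * ‖x‖ ^ 2 := by rw [sq]; exact e2
  have y0 : 0 ≤ ‖x‖ ^ 2 := by positivity
  have hηx : ηh * ‖x‖ ^ 2 ≤ 1 / 2 * ‖x‖ ^ 2 := by gcongr; linarith
  have hP : ‖t.P k‖ ≤ 2 * ‖x‖ ^ 2 := by
    have h2 := norm_le_norm_add_norm_sub' (t.P k) (xᵀ * x)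
    rw [norm_transpose_mul_self] at h2
    linarith
  have hSS : ‖S‖ * ‖S‖ ≤ 16 * ‖x‖ ^ 2 := by
    calc ‖S‖ * ‖S‖ ≤ (4 * ‖x‖) * (4 * ‖x‖) := by gcongr
      _ = _ := by ring
  have f3 : ‖t.G k - Sᵀ * S‖ ≤ 16 * (ηh * ‖x‖ ^ 2) := by
    refine e3.trans ?_
    calc ηh * (‖S‖ * ‖S‖) ≤ ηh * (16 * ‖x‖ ^ 2) := by gcongr
      _ = _ := by ring
  have hG : ‖t.G k‖ ≤ 32 * ‖x‖ ^ 2 := by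
    have h2 := norm_le_norm_add_norm_sub' (t.G k) (Sᵀ * S)
    rw [norm_transpose_mul_self, sq] at h2
    linarith
  have hPG : ‖t.P k - t.G k‖ ≤ 34 * ‖x‖ ^ 2 := (norm_sub_le _ _).trans (by linarith)
  have f4 : ‖t.H k - (t.P k - t.G k)‖ ≤ 34 * (ηh * ‖x‖ ^ 2) := by
    refine e4.trans ?_
    calc ηh * ‖t.P k - t.G k‖ ≤ ηh * (34 * ‖x‖ ^ 2) := by gcongr
      _ = _ := by ring
  have hH : ‖t.H k‖ ≤ 68 * ‖x‖ ^ 2 := by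
    have h2 := norm_le_norm_add_norm_sub' (t.H k) (t.P k - t.G k)
    linarith
  have f5 : ‖t.H k - (t.P k - Sᵀ * S)‖ ≤ 50 * ηh * ‖x‖ ^ 2 := by
    rw [show t.H k - (t.P k - Sᵀ * S) = (t.H k - (t.P k - t.G k)) - (t.G k - Sᵀ * S) by abel]
    exact (norm_sub_le _ _).trans (by linarith)
  -- Entries `(i, j)` and `(j, i)` may be summed in different orders, so the computed `H` need not
  -- be symmetric; it is close to the symmetric matrix `xᵀx - SᵀS`.
  have hsymm : ∀ i j, |t.H k i j - t.H k j i| ≤ 102 * ηh * ‖x‖ ^ 2 := by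
    intro i j
    set F := t.H k - (xᵀ * x - Sᵀ * S) with hF
    have hFn : ‖F‖ ≤ 51 * ηh * ‖x‖ ^ 2 := by
      rw [hF, show t.H k - (xᵀ * x - Sᵀ * S)
        = (t.H k - (t.P k - Sᵀ * S)) + (t.P k - xᵀ * x) by abel]
      exact (norm_add_le _ _).trans (by linarith)
    have h1 : t.H k i j - t.H k j i = F i j - F j i := by
      have h2 : (xᵀ * x - Sᵀ * S) i j = (xᵀ * x - Sᵀ * S) j i := by
        simp only [Matrix.sub_apply, Matrix.mul_apply, Matrix.transpose_apply, mul_comm]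
      rw [hF, Matrix.sub_apply, Matrix.sub_apply (t.H k), h2]
      ring
    rw [h1]
    have h3 := abs_apply_le_norm F i j
    have h4 := abs_apply_le_norm F j i
    have h5 := abs_sub (F i j) (F j i)
    linarith
  -- This error is of low-precision size because `T` is the rounded factor. The constant is `34 * 68
  -- + 102`.
  have f6 : ‖Tᵀ * T - t.H k‖ ≤ 2414 * D ^ 2 * ηl * ‖x‖ ^ 2 := by
    have h1 := hch.abs_sub_le_of_cast hcR hεh hε (Nat.succ_le_succ hsp) hγ
      (fun i j => (abs_apply_le_norm (t.H k) i j).trans hH) hsymm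
    have h2 := norm_le_of_forall_abs_le (by positivity) h1
    refine h2.trans ?_
    rw [Fintype.card_fin]
    calc (s : ℝ) * s * (34 * s * gam εl (D + 1) * (68 * ‖x‖ ^ 2) + 102 * ηh * ‖x‖ ^ 2)
        ≤ D * D * (34 * D * gam εl (D + 1) * (68 * ‖x‖ ^ 2) + 102 * ηl * ‖x‖ ^ 2) := by gcongr
      _ = 1 * (2312 * ηl * ‖x‖ ^ 2) + D ^ 2 * (102 * ηl * ‖x‖ ^ 2) := by rw [hηl]; ring
      _ ≤ D ^ 2 * (2312 * ηl * ‖x‖ ^ 2) + D ^ 2 * (102 * ηl * ‖x‖ ^ 2) := by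
        gcongr
        exact one_le_pow₀ hD'
      _ = _ := by ring
  have hQS : ‖Q‖ * ‖S‖ ≤ 8 * ‖x‖ := by
    calc ‖Q‖ * ‖S‖ ≤ 2 * (4 * ‖x‖) := by gcongr
      _ = _ := by ring
  have f7 : ‖t.W k - Q * S‖ ≤ 8 * (ηl * ‖x‖) := by
    refine e5.trans ?_
    calc ηl * (‖Q‖ * ‖S‖) ≤ ηl * (8 * ‖x‖) := by gcongr
      _ = _ := by ring
  have hηlx : ηl * ‖x‖ ≤ 1 / 2 * ‖x‖ := by gcongr
  have hW : ‖t.W k‖ ≤ 16 * ‖x‖ := by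
    have h2 := norm_le_norm_add_norm_sub' (t.W k) (Q * S)
    have h3 := norm_mul_le' Q S
    linarith
  have f8 : ‖t.V k - (x - Q * S)‖ ≤ 25 * ηl * ‖x‖ := by
    have h1 : ‖x - t.W k‖ ≤ 17 * ‖x‖ := (norm_sub_le _ _).trans (by linarith)
    have h2 : ‖t.V k - (x - t.W k)‖ ≤ ηl * (17 * ‖x‖) := e6.trans (by gcongr)
    rw [show t.V k - (x - Q * S) = (t.V k - (x - t.W k)) - (t.W k - Q * S) by abel]
    exact (norm_sub_le _ _).trans (by linarith)
  have f9 : ‖q * T - t.V k‖ ≤ 34 * ηl * (‖q‖ * ‖T‖) := by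
    have hεl2 : εh ≤ 1 / 2 := hε.trans ((le_gam hεl (Nat.succ_le_succ (Nat.zero_le D))).trans hγ)
    have h1 : ∀ i j, |(q * T - t.V k) i j| ≤ 34 * gam εl (D + 1) * (s * (‖q‖ * ‖T‖)) := by
      intro i j
      refine (hsol.abs_sub_le_of_cast hcQ hcR hεh hε (Nat.succ_le_succ hsp) hγ hch.1
        (hch.diag_ne_zero hεl2) i j).trans ?_
      have := sum_abs_mul_le q T i j
      rw [Fintype.card_fin] at this
      gcongr
    refine (norm_le_of_forall_abs_le (by positivity) h1).trans ?_
    rw [Fintype.card_fin, Fintype.card_fin]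
    calc (m : ℝ) * s * (34 * gam εl (D + 1) * (s * (‖q‖ * ‖T‖)))
        ≤ D * D * (34 * gam εl (D + 1) * (D * (‖q‖ * ‖T‖))) := by gcongr
      _ = _ := by rw [hηl]; ring
  have hk0 : (k : ℕ) ≠ 0 := hk.ne'
  refine ⟨fun h => (hk0 h).elim, fun h => (hk0 h).elim, fun _ => f1.trans ?_, fun _ => f2.trans ?_,
    fun _ => f5.trans ?_, fun _ => f6.trans ?_, fun _ => f8.trans ?_, fun _ => f9.trans ?_⟩ <;>
    gcongr

/-- Error constants that are all multiples of the unit roundoffs. -/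
def unitConsts (c εh εl : ℝ) : ErrConsts where
  ξ₁ := c * εl
  ρ₁ := c * εl
  δQX := c * εl
  δXX := c * εh
  δRR := c * εh
  δchol := c * εl
  δQR := c * εl
  δQ := c * εl

theorem unitConsts_nonneg {c : ℝ} (hc : 0 ≤ c) (hεh : 0 ≤ εh) (hεl : 0 ≤ εl) :
    (unitConsts c εh εl).Nonneg := by
  simp only [ErrConsts.Nonneg, unitConsts]
  have := mul_nonneg hc hεl
  have := mul_nonneg hc hεh
  exact ⟨‹_›, ‹_›, ‹_›, ‹_›, ‹_›, ‹_›, ‹_›, ‹_›⟩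

/-- The factor of the unit roundoffs in the error constants, for dimensions with sum `D` and a
factor `a` for the intraorthogonalization. -/
def stepFactor (a D : ℝ) : ℝ := 2500 * D ^ 2 * (2 * D ^ 3 * (D + 1)) + a ^ 2 + 1

theorem stepFactor_nonneg (a : ℝ) {D : ℝ} (hD : 0 ≤ D) : 0 ≤ stepFactor a D := by
  unfold stepFactor; positivity

/-- The terms `a ^ 2 + 1` dominate `a` whatever its sign and remain polynomial, which `|a|` would
not. -/
theorem le_stepFactor (a : ℝ) {D : ℝ} (hD : 0 ≤ D) : a ≤ stepFactor a D := by
  have : 0 ≤ 2500 * D ^ 2 * (2 * D ^ 3 * (D + 1)) := by positivity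
  unfold stepFactor
  nlinarith [sq_nonneg (a - 1)]

/-- The rounding errors in the processing of any block, provided that the unit roundoffs are
small. -/
theorem IsPIPMP.stepBounds (ht : IsPIPMP εh εl X intra t) (hεh : 0 ≤ εh) (hε : εh ≤ εl)
    (hs : 0 < s) (hX : LinearIndependent ℝ X.col) {a : ℝ}
    (hintra : ∀ Y : Matrix (Fin m) (Fin s) ℝ, LinearIndependent ℝ Y.col →
      condNum Y ≤ condNum X →
      ‖(intra Y).2ᵀ * (intra Y).2 - Yᵀ * Y‖ ≤ a * εl * ‖Y‖ ^ 2 ∧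
      ‖(intra Y).1 * (intra Y).2 - Y‖ ≤ a * εl * ‖Y‖)
    (hsmall : stepFactor a (m + p * s : ℕ) * εl ≤ 1 / 4) (k : Fin p)
    (hQ : 0 < (k : ℕ) → ‖lead t.Q k.isLt.le‖ ≤ 2) :
    StepBounds (unitConsts (stepFactor a (m + p * s : ℕ)) εh εl) X t k := by
  have hεl := hεh.trans hε
  have hp := Fin.pos k
  set D := m + p * s with hDdef
  have hD : 1 ≤ D := (Nat.mul_pos hp hs).trans_le (Nat.le_add_left _ _)
  have hD' : (1 : ℝ) ≤ D := by exact_mod_cast hD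
  have hac := le_stepFactor a (zero_le_one.trans hD')
  rcases Nat.eq_zero_or_pos (k : ℕ) with hk | hk
  · have : Nonempty (Fin s) := ⟨⟨0, hs⟩⟩
    have : Nonempty (Fin p × Fin s) := ⟨(k, ⟨0, hs⟩)⟩
    have hκ : condNum (blk X k) ≤ condNum X := condNum_submatrix_cols_le hX (mk_injective k)
    obtain ⟨h1, h2⟩ := hintra (blk X k) (linearIndependent_blk hX k) hκ
    rw [← ht.first k hk] at h1 h2
    refine ⟨fun _ => h1.trans ?_, fun _ => h2.trans ?_, fun h => (h.ne' hk).elim,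
      fun h => (h.ne' hk).elim, fun h => (h.ne' hk).elim, fun h => (h.ne' hk).elim,
      fun h => (h.ne' hk).elim, fun h => (h.ne' hk).elim⟩
    · simp only [unitConsts]
      gcongr
    · simp only [unitConsts]
      have h3 : 0 ≤ ‖blk t.Q k‖ * ‖diagBlk t.R k‖ := by positivity
      have h4 := stepFactor_nonneg a (zero_le_one.trans hD')
      gcongr
      linarith
  · set B : ℝ := 2 * D ^ 3 * (D + 1) with hB
    have hB0 : 0 ≤ B := by positivity
    have hDB : (D : ℝ) + 1 ≤ B := by
      have : (1 : ℝ) ≤ 2 * (D : ℝ) ^ 3 := by linarith [one_le_pow₀ hD' (n := 3)]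
      exact le_mul_of_one_le_left (by positivity) this
    have hD2 : (1 : ℝ) ≤ (D : ℝ) ^ 2 := one_le_pow₀ hD'
    have hcB : 2500 * (D : ℝ) ^ 2 * B ≤ stepFactor a D := by
      unfold stepFactor
      linarith [sq_nonneg a]
    have hBD : B ≤ (D : ℝ) ^ 2 * B := le_mul_of_one_le_left hB0 hD2
    have hBε : 2500 * (B * εl) ≤ 1 / 4 := by
      refine le_trans ?_ hsmall
      rw [← mul_assoc]
      gcongr
      linarith
    have hη : ∀ u : ℝ, 0 ≤ u → u ≤ εl → (D : ℝ) ^ 3 * gam u (D + 1) ≤ B * u := by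
      intro u hu hul
      have h1 : ((D + 1 : ℕ) : ℝ) * u ≤ 1 := by
        push_cast
        have : ((D : ℝ) + 1) * u ≤ B * εl := by gcongr
        linarith
      have h2 := gam_le_two_mul hu h1
      push_cast at h2
      calc (D : ℝ) ^ 3 * gam u (D + 1) ≤ D ^ 3 * (2 * ((D + 1) * u)) := by gcongr
        _ = B * u := by rw [hB]; ring
    have hηl := hη εl hεl le_rfl
    have hηh := hη εh hεh hε
    have hmain : ∀ (r u : ℝ), 0 ≤ u → 0 ≤ r → r ≤ 2500 → r * (B * u) ≤ stepFactor a D * u := by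
      intro r u hu hr0 hr
      rw [← mul_assoc]
      gcongr
      calc r * B ≤ 2500 * (D ^ 2 * B) := by gcongr
        _ ≤ _ := by linarith
    refine ht.stepBounds_of_pos hεh hε hD (Nat.le_add_right _ _) (Nat.le_add_left _ _)
      (by linarith) hk (hQ hk) ?_ ?_ ?_ ?_ ?_ ?_
    · exact le_trans (by linarith) (hmain 2 εl hεl (by norm_num) (by norm_num))
    · exact le_trans (by linarith) (hmain 1 εh hεh (by norm_num) (by norm_num))
    · exact le_trans (by linarith) (hmain 50 εh hεh (by norm_num) (by norm_num))
    · calc 2414 * (D : ℝ) ^ 2 * (D ^ 3 * gam εl (D + 1)) ≤ 2500 * (D : ℝ) ^ 2 * (B * εl) := by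
            have := gam_nonneg hεl (D + 1)
            gcongr
            norm_num
        _ = 2500 * (D : ℝ) ^ 2 * B * εl := by ring
        _ ≤ stepFactor a D * εl := by gcongr
    · exact le_trans (by linarith) (hmain 25 εl hεl (by norm_num) (by norm_num))
    · exact le_trans (by linarith) (hmain 34 εl hεl (by norm_num) (by norm_num))

/-- Constants of the order of the unit roundoffs are valid, if they are small relative to the
condition number. -/
theorem IsPIPMP.bounds_unitConsts (ht : IsPIPMP εh εl X intra t) (hεh : 0 ≤ εh) (hε : εh ≤ εl)
    (hp : 0 < p) (hs : 0 < s) (hX : LinearIndependent ℝ X.col) {a : ℝ}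
    (hintra : ∀ Y : Matrix (Fin m) (Fin s) ℝ, LinearIndependent ℝ Y.col →
      condNum Y ≤ condNum X →
      ‖(intra Y).2ᵀ * (intra Y).2 - Yᵀ * Y‖ ≤ a * εl * ‖Y‖ ^ 2 ∧
      ‖(intra Y).1 * (intra Y).2 - Y‖ ≤ a * εl * ‖Y‖)
    (hsmall : (unitConsts (stepFactor a (m + p * s : ℕ)) εh εl).Small X) :
    (unitConsts (stepFactor a (m + p * s : ℕ)) εh εl).Bounds X t := by
  have hc := stepFactor_nonneg a (Nat.cast_nonneg (α := ℝ) (m + p * s))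
  have h0 : (unitConsts (stepFactor a (m + p * s : ℕ)) εh εl).Nonneg :=
    unitConsts_nonneg hc hεh (hεh.trans hε)
  have : Nonempty (Fin p × Fin s) := ⟨(⟨0, hp⟩, ⟨0, hs⟩)⟩
  -- The left side is `ρ_1`, and the condition number is at least 1.
  have hε1 : stepFactor a (m + p * s : ℕ) * εl ≤ 1 / 4 := by
    have h1 := (hsmall.rho_xi_le h0 hp).1
    have h2 : (1 : ℝ) ≤ condNum X ^ 2 := one_le_pow₀ (one_le_condNum hX)
    exact (le_mul_of_one_le_right (h0.rho_nonneg 1) h2).trans h1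
  have key : ∀ (n : ℕ) (k : Fin p), (k : ℕ) = n →
      StepBounds (unitConsts (stepFactor a (m + p * s : ℕ)) εh εl) X t k := by
    intro n
    induction n using Nat.strong_induction_on with
    | _ n ih =>
      intro k hk
      -- Processing block `k` uses only the basis of the preceding blocks, whose norm is at most 1.4
      -- by the accuracy already established for them.
      refine ht.stepBounds hεh hε hs hX hintra hε1 k fun hk0 => ?_
      obtain ⟨hE, hD⟩ := gramErr_resErr_le ht.lower hX hs h0 hsmall hk0 k.isLt.le
        fun j hj => ih j (hk ▸ hj) j rfl
      have := (norm_lead_le_of_lt hX hs h0 hsmall hk0 k.isLt hE hD).2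
      linarith
  exact ErrConsts.Bounds.of_stepBounds h0 fun k => key k k rfl

/-- Residuals and Gram errors accumulate only linearly and quadratically in the number of blocks,
as long as the factors stay bounded. -/
theorem resErr_gramErr_le_of_bounded
    (hR : ∀ (i j : Fin p) (a b : Fin s), j < i → t.R (i, a) (j, b) = 0) {c : ℝ} (hc : 0 ≤ c)
    (hεh : 0 ≤ εh) (hε : εh ≤ εl) (hstep : ∀ j, StepBounds (unitConsts c εh εl) X t j)
    (hb : ∀ (k : ℕ) (hk : k ≤ p), 1 ≤ k →
      ‖leadSq t.R hk‖ ≤ 1.25 * ‖lead X hk‖ ∧ ‖lead t.Q hk‖ ≤ 4) {k : ℕ} (hk0 : 1 ≤ k)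
    (hk : k ≤ p) : resErr X t hk ≤ k * (6 * (c * εl)) * ‖lead X hk‖ ∧
      gramErr X t hk ≤ k * ((12 * p + 6) * (c * εl)) * ‖lead X hk‖ ^ 2 := by
  have hd : 0 ≤ c * εl := mul_nonneg hc (hεh.trans hε)
  have hdh : c * εh ≤ c * εl := by gcongr
  set d := c * εl with hd'
  have hprod : ∀ {k : ℕ} (hk : k + 1 ≤ p),
      ‖blk t.Q ⟨k, hk⟩‖ * ‖diagBlk t.R ⟨k, hk⟩‖ ≤ 5 * ‖lead X hk‖ := by
    intro k hk
    obtain ⟨h1, h2⟩ := hb (k + 1) hk (Nat.succ_le_succ (Nat.zero_le k))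
    calc ‖blk t.Q ⟨k, hk⟩‖ * ‖diagBlk t.R ⟨k, hk⟩‖ ≤ 4 * (1.25 * ‖lead X hk‖) := by
          gcongr
          · exact (norm_blk_le_norm_lead t.Q hk).trans h2
          · exact (norm_diagBlk_le_norm_leadSq t.R hk).trans h1
      _ = _ := by ring
  induction k, hk0 using Nat.le_induction with
  | base =>
    have h1 := hprod (k := 0) hk
    have h2 := norm_blk_le_norm_lead X (k := 0) hk
    have hX0 := norm_nonneg (blk X ⟨0, hk⟩)
    have h3 := gramErr_one_le hR hk (hstep ⟨0, hk⟩)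
    have h4 := (resErr_one_le hR hk).trans ((hstep ⟨0, hk⟩).firstRes rfl)
    simp only [unitConsts, ← hd'] at h3 h4
    constructor
    · refine h4.trans ?_
      calc d * (‖blk X ⟨0, hk⟩‖ + ‖blk t.Q ⟨0, hk⟩‖ * ‖diagBlk t.R ⟨0, hk⟩‖)
          ≤ d * (‖lead X hk‖ + 5 * ‖lead X hk‖) := by gcongr
        _ = _ := by push_cast; ring
    · refine h3.trans ?_
      have h5 : d ≤ ((1 : ℕ) : ℝ) * ((12 * p + 6) * d) := by
        push_cast
        have : 0 ≤ (p : ℝ) * d := by positivity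
        linarith
      gcongr
  | succ k hk1 ih =>
    obtain ⟨hD, hE⟩ := ih (Nat.le_of_succ_le hk)
    have h1 := hprod hk
    have h2 := norm_blk_le_norm_lead X hk
    have h3 := gramErr_succ_le hR hk1 hk (hstep ⟨k, hk⟩)
    have h4 := resErr_succ_le hR hk1 hk (hstep ⟨k, hk⟩)
    have h5 := (hb k (Nat.le_of_succ_le hk) hk1).1
    have h6 := norm_lead_le_of_le X (Nat.le_succ k) hk
    simp only [unitConsts, ← hd'] at h3 h4
    have hkp : (k : ℝ) ≤ p := by exact_mod_cast Nat.le_of_succ_le hk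
    set x := ‖blk X ⟨k, hk⟩‖
    set K := ‖lead X hk‖
    set K' := ‖lead X (Nat.le_of_succ_le hk)‖
    have x0 : 0 ≤ x := norm_nonneg _
    have K0 : 0 ≤ K' := norm_nonneg _
    have hK0 : 0 ≤ K := norm_nonneg _
    constructor
    · refine h4.trans ?_
      calc resErr X t (Nat.le_of_succ_le hk) + (d * x
            + d * (‖blk t.Q ⟨k, hk⟩‖ * ‖diagBlk t.R ⟨k, hk⟩‖))
          ≤ k * (6 * d) * K + (d * K + d * (5 * K)) := by
            gcongr
            exact hD.trans (by gcongr)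
        _ = _ := by push_cast; ring
    · refine h3.trans ?_
      -- Doubled, this is the source of `12 * p`; the other contributions, `2 * 1.25 + 3`, fit into
      -- the 6.
      have i1 : resErr X t (Nat.le_of_succ_le hk) * x ≤ (p * (6 * d) * K) * K := by
        have : resErr X t (Nat.le_of_succ_le hk) ≤ p * (6 * d) * K := hD.trans (by gcongr)
        exact mul_le_mul this h2 x0 (by positivity)
      have i2 : ‖leadSq t.R (Nat.le_of_succ_le hk)‖ * (d * x) ≤ 1.25 * K * (d * K) := by
        refine mul_le_mul (h5.trans (by gcongr)) (by gcongr) (by positivity) (by positivity)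
      have i3 : (c * εh + d + c * εh) * x ^ 2 ≤ (d + d + d) * K ^ 2 := by gcongr
      have i4 : gramErr X t (Nat.le_of_succ_le hk) ≤ k * ((12 * p + 6) * d) * K ^ 2 :=
        hE.trans (by gcongr)
      have i5 : 0 ≤ d * K ^ 2 := by positivity
      push_cast
      linarith

/-- The accuracy of two-precision BCGS-PIP. -/
theorem IsPIPMP.accuracy (ht : IsPIPMP εh εl X intra t) (hεh : 0 ≤ εh) (hε : εh ≤ εl)
    (hp : 0 < p) (hs : 0 < s) (hX : LinearIndependent ℝ X.col) {a : ℝ}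
    (hintra : ∀ Y : Matrix (Fin m) (Fin s) ℝ, LinearIndependent ℝ Y.col →
      condNum Y ≤ condNum X →
      ‖(intra Y).2ᵀ * (intra Y).2 - Yᵀ * Y‖ ≤ a * εl * ‖Y‖ ^ 2 ∧
      ‖(intra Y).1 * (intra Y).2 - Y‖ ≤ a * εl * ‖Y‖)
    {e : ErrConsts} (he : e.Bounds X t) (hsmall : e.Small X) {C : ℝ}
    (hC : C = (84 * ((m + p * s : ℕ) : ℝ) ^ 2 + 68) * stepFactor a (m + p * s : ℕ))
    {k : ℕ} (hk : k ≤ p) (hk1 : 1 ≤ k) :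
    ‖(leadSq t.R hk)ᵀ * leadSq t.R hk - (lead X hk)ᵀ * lead X hk‖ ≤ C * εl * ‖lead X hk‖ ^ 2 ∧
      ‖lead t.Q hk * leadSq t.R hk - lead X hk‖ ≤ C * εl * ‖lead X hk‖ ∧
      ‖1 - (lead t.Q hk)ᵀ * lead t.Q hk‖ ≤ C * εl * condNum (lead X hk) ^ 2 := by
  have hεl := hεh.trans hε
  have h0 : e.Nonneg := he.nonneg
  have hED : ∀ (k : ℕ) (hk : k ≤ p), 1 ≤ k → gramErr X t hk ≤ e.xi k * ‖lead X hk‖ ^ 2 ∧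
      resErr X t hk ≤ e.rho k * (‖lead X hk‖ + ‖lead t.Q hk‖ * ‖leadSq t.R hk‖) :=
    fun k hk hk1 => gramErr_resErr_le ht.lower hX hs h0 hsmall hk1 hk fun j _ => he.stepBounds j
  have hb : ∀ (k : ℕ) (hk : k ≤ p), 1 ≤ k →
      ‖leadSq t.R hk‖ ≤ 1.25 * ‖lead X hk‖ ∧ ‖lead t.Q hk‖ ≤ 4 := fun k hk hk1 =>
    norm_lead_le_of_le' hX hs h0 hsmall hk1 hk (hED k hk hk1).1 (hED k hk hk1).2
  have : Nonempty (Fin k × Fin s) := ⟨(⟨0, hk1⟩, ⟨0, hs⟩)⟩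
  have hXk := linearIndependent_lead hX hk
  have hσ := sigmaMin_pos hXk
  have hσK := sigmaMin_le_norm (lead X hk)
  have hκ := one_le_condNum hXk
  obtain ⟨hE, hD⟩ := hED k hk hk1
  obtain ⟨hRk, hQk⟩ := hb k hk hk1
  have hsm := hsmall.rho_xi_le h0 hk
  have hξ := mul_norm_sq_lead_le hX hs hk1 hk (h0.xi_nonneg k) hsm.2
  have hρ := mul_norm_sq_lead_le hX hs hk1 hk (h0.rho_nonneg k) hsm.1
  have hσK2 := pow_le_pow_left₀ hσ.le hσK 2
  have hK : 0 < ‖lead X hk‖ := hσ.trans_le hσK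
  have hE' := hE.trans hξ
  have hρ' : e.rho k ≤ 1 / 4 :=
    le_of_mul_le_mul_right (hρ.trans (by gcongr)) (pow_pos hK 2)
  have hD' : resErr X t hk ≤ 2 * ‖lead X hk‖ := by
    refine hD.trans ?_
    calc e.rho k * (‖lead X hk‖ + ‖lead t.Q hk‖ * ‖leadSq t.R hk‖)
        ≤ 1 / 4 * (‖lead X hk‖ + 4 * (1.25 * ‖lead X hk‖)) := by
          have := h0.rho_nonneg k
          gcongr
      _ ≤ _ := by linarith
  set D : ℝ := ((m + p * s : ℕ) : ℝ) with hDdef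
  have hD0 : 0 ≤ D := Nat.cast_nonneg _
  have hc := stepFactor_nonneg a hD0
  have hcε : 0 ≤ stepFactor a D * εl := mul_nonneg hc hεl
  have hpD : (p : ℝ) ≤ D := by
    rw [hDdef]
    exact_mod_cast (Nat.le_mul_of_pos_right p hs).trans (Nat.le_add_left _ _)
  have hCε : C * εl = 84 * (D ^ 2 * (stepFactor a D * εl)) + 68 * (stepFactor a D * εl) := by
    rw [hC]; ring
  have hDc : 0 ≤ D ^ 2 * (stepFactor a D * εl) := by positivity
  -- From here on `e` matters only through the bounds on the factors. If the roundoff is small, the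
  -- errors are recomputed with constants of order `εl`.
  by_cases hcase : stepFactor a D * εl ≤ 1 / 4
  · have hstep : ∀ j, StepBounds (unitConsts (stepFactor a D) εh εl) X t j := by
      intro j
      refine ht.stepBounds hεh hε hs hX hintra hcase j fun hj => ?_
      obtain ⟨h1, h2⟩ := hED j j.isLt.le hj
      have := (norm_lead_le_of_lt hX hs h0 hsmall hj j.isLt h1 h2).2
      linarith
    obtain ⟨h1, h2⟩ := resErr_gramErr_le_of_bounded ht.lower hc hεh hε hstep hb hk1 hk
    set d := stepFactor a D * εl
    have hp1 : (1 : ℝ) ≤ p := by exact_mod_cast hp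
    have hkp : (k : ℝ) ≤ p := by exact_mod_cast hk
    have hpp : (p : ℝ) * d ≤ D ^ 2 * d := by
      have : (p : ℝ) ≤ D ^ 2 := by nlinarith
      gcongr
    have i1 : (k : ℝ) * (6 * d) ≤ 6 * (D ^ 2 * d) := by
      calc (k : ℝ) * (6 * d) ≤ p * (6 * d) := by gcongr
        _ = 6 * (p * d) := by ring
        _ ≤ _ := by linarith
    have i2 : (k : ℝ) * ((12 * p + 6) * d) ≤ 18 * (D ^ 2 * d) := by
      calc (k : ℝ) * ((12 * p + 6) * d) ≤ D * ((12 * D + 6 * D) * d) := by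
            gcongr
            · exact hkp.trans hpD
            · linarith
        _ = _ := by ring
    have j1 : resErr X t hk ≤ 6 * (D ^ 2 * d) * ‖lead X hk‖ := h1.trans (by gcongr)
    have j2 : gramErr X t hk ≤ 18 * (D ^ 2 * d) * ‖lead X hk‖ ^ 2 := h2.trans (by gcongr)
    refine ⟨j2.trans ?_, j1.trans ?_, ?_⟩
    · rw [hCε]
      gcongr
      linarith
    · rw [hCε]
      gcongr
      linarith
    -- This is where 84 comes from: `2 * (18 + 4 * 6)`.
    · refine (norm_one_sub_gram_le hXk j2 hE' j1 hD').trans ?_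
      rw [hCε]
      gcongr
      linarith
  -- For a large roundoff the claims are weak: `68 / 4 = 17 = 1 + 4 ^ 2` covers the trivial bound on
  -- the loss of orthogonality, and it exceeds the constants 1/2 and 2 of the a priori bounds.
  · have h17 : 17 ≤ C * εl := by
      rw [hCε]; linarith [not_le.1 hcase]
    have hκ2 : 1 ≤ condNum (lead X hk) ^ 2 := one_le_pow₀ hκ
    refine ⟨hE'.trans ?_, hD'.trans ?_, ?_⟩
    · calc 1 / 2 * sigmaMin (lead X hk) ^ 2 ≤ 17 * ‖lead X hk‖ ^ 2 := by gcongr; norm_num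
        _ ≤ _ := by gcongr
    · gcongr
      linarith
    · have h1 : ‖1 - (lead t.Q hk)ᵀ * lead t.Q hk‖ ≤ 1 + ‖lead t.Q hk‖ ^ 2 := by
        rw [← norm_transpose_mul_self]
        exact (norm_sub_le _ _).trans (add_le_add norm_one_le le_rfl)
      have h2 := pow_le_pow_left₀ (norm_nonneg _) hQk 2
      have h3 : 17 * 1 ≤ C * εl * condNum (lead X hk) ^ 2 := by gcongr
      linarith

end Run

/-! ### The constants as polynomials in the dimensions. -/

/-- The polynomial whose value is the sum of the dimensions. -/
def dimSum : MvPolynomial (Fin 2) ℝ := MvPolynomial.X 0 + MvPolynomial.X 1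

/-- The polynomial with the values `stepFactor`. -/
def stepPoly (c₀ : MvPolynomial (Fin 2) ℝ) : MvPolynomial (Fin 2) ℝ :=
  2500 * dimSum ^ 2 * (2 * dimSum ^ 3 * (dimSum + 1)) + c₀ ^ 2 + 1

theorem dimConst_dimSum (m p s : ℕ) : dimConst dimSum m p s = ((m + p * s : ℕ) : ℝ) := by
  simp [dimConst, dimSum]

theorem dimConst_stepPoly (c₀ : MvPolynomial (Fin 2) ℝ) (m p s : ℕ) :
    dimConst (stepPoly c₀) m p s = stepFactor (dimConst c₀ m p s) ((m + p * s : ℕ) : ℝ) := by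
  rw [← dimConst_dimSum]
  simp [dimConst, stepPoly, stepFactor]

theorem dimConst_accuracyPoly (c₀ : MvPolynomial (Fin 2) ℝ) (m p s : ℕ) :
    dimConst ((84 * dimSum ^ 2 + 68) * stepPoly c₀) m p s
      = (84 * ((m + p * s : ℕ) : ℝ) ^ 2 + 68)
        * stepFactor (dimConst c₀ m p s) ((m + p * s : ℕ) : ℝ) := by
  rw [← dimConst_stepPoly, ← dimConst_dimSum]
  simp [dimConst]

end BlockGS

end

theorem mainTheorem8 (c₀ : MvPolynomial (Fin 2) ℝ) :
    ∃ c C : MvPolynomial (Fin 2) ℝ,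
      ∀ (m p s : ℕ), 0 < p → 0 < s →
      ∀ (εh εl : ℝ), 0 < εh → εh ≤ εl → εl < 1 →
      ∀ (X : Matrix (Fin m) (Fin p × Fin s) ℝ), LinearIndependent ℝ X.col →
      ∀ (intra : Matrix (Fin m) (Fin s) ℝ → Matrix (Fin m) (Fin s) ℝ × Matrix (Fin s) (Fin s) ℝ),
      (∀ Y : Matrix (Fin m) (Fin s) ℝ, LinearIndependent ℝ Y.col →
        BlockGS.condNum Y ≤ BlockGS.condNum X →
        ‖(intra Y).2ᵀ * (intra Y).2 - Yᵀ * Y‖ ≤ BlockGS.dimConst c₀ m p s * εl * ‖Y‖ ^ 2 ∧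
        ‖(intra Y).1 * (intra Y).2 - Y‖ ≤ BlockGS.dimConst c₀ m p s * εl * ‖Y‖) →
      ∀ (t : BlockGS.Trace m p s), BlockGS.IsPIPMP εh εl X intra t →
        -- the bounds, for all valid error constants
        (∀ e : BlockGS.ErrConsts, e.Bounds X t → e.Small X →
          ∀ (k : ℕ) (hk : k ≤ p), 1 ≤ k →
            ‖(BlockGS.leadSq t.R hk)ᵀ * BlockGS.leadSq t.R hk
                - (BlockGS.lead X hk)ᵀ * BlockGS.lead X hk‖
              ≤ BlockGS.dimConst C m p s * εl * ‖BlockGS.lead X hk‖ ^ 2 ∧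
            ‖BlockGS.lead t.Q hk * BlockGS.leadSq t.R hk - BlockGS.lead X hk‖
              ≤ BlockGS.dimConst C m p s * εl * ‖BlockGS.lead X hk‖ ∧
            ‖1 - (BlockGS.lead t.Q hk)ᵀ * BlockGS.lead t.Q hk‖
              ≤ BlockGS.dimConst C m p s * εl * BlockGS.condNum (BlockGS.lead X hk) ^ 2) ∧
        -- constants of the order of the unit roundoffs are valid
        (∀ e : BlockGS.ErrConsts,
          e = { ξ₁ := BlockGS.dimConst c m p s * εl
                ρ₁ := BlockGS.dimConst c m p s * εl
                δQX := BlockGS.dimConst c m p s * εl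
                δXX := BlockGS.dimConst c m p s * εh
                δRR := BlockGS.dimConst c m p s * εh
                δchol := BlockGS.dimConst c m p s * εl
                δQR := BlockGS.dimConst c m p s * εl
                δQ := BlockGS.dimConst c m p s * εl } →
          e.Small X → e.Bounds X t) := by
  refine ⟨BlockGS.stepPoly c₀, (84 * BlockGS.dimSum ^ 2 + 68) * BlockGS.stepPoly c₀, ?_⟩
  intro m p s hp hs εh εl hεh hε _ X hX intra hintra t ht
  refine ⟨fun e he hsmall k hk hk1 => ?_, ?_⟩
  · exact ht.accuracy hεh.le hε hp hs hX hintra he hsmall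
      (BlockGS.dimConst_accuracyPoly c₀ m p s) hk hk1
  · rintro e rfl hsmall
    rw [BlockGS.dimConst_stepPoly] at hsmall ⊢
    exact ht.bounds_unitConsts hεh.le hε hp hs hX hintra hsmall
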